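/- Let $k$ be an algebraically closed field of characteristic $0$ and let $q,p\in k$ satisfy $p^2=q^2+q^3$. Let $A$ be the unital associative $k$-algebra with generators $x,y,a,a^{-1},b$ and relations \begin{gather*} aa^{-1}=a^{-1}a=1,\qquad y^2=x^2+x^3,\qquad b^2=a^3,\\ ba=ab,\qquad ya=ay,\qquad bx=xb,\qquad yx=xy,\qquad by=-yb+2pb^2,\\ a^2x=-xa^2-axa-a^2+(1+3q)a^3,\\ ax^2=-ax-xa-x^2a-xax+(2+3q)q\,a^3 . \end{gather*} (In particular $b$ is invertible in $A$, with $b^{-1}=ba^{-3}$.) Then $A$ admits a Hopf algebra structure whose coproduct $\Delta$, counit $\varepsilon$ and antipode $S$ satisfy \begin{gather*} \Delta(x)=1\otimes(x-qa)+x\otimes a,\qquad \Delta(y)=1\otimes(y-pb)+y\otimes b,\\ \Delta(a)=a\otimes a,\quad \Delta(b)=b\otimes b,\quad \varepsilon(x)=q,\quad \varepsilon(y)=p,\quad \varepsilon(a)=\varepsilon(b)=1,\\ S(x)=q-(x-q)a^{-1},\quad S(y)=p-(y-p)b^{-1},\quad S(a)=a^{-1},\quad S(b)=b^{-1}. \end{gather*}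 Furthermore, let $B\subset A$ be the subalgebra generated by $x$ and $y$. It is a right coideal, i.e. $\Delta(B)\subset B\otimes A$; it is the coordinate ring of the nodal cubic, i.e. there is a $k$-algebra isomorphism $k[X,Y]/(Y^2-X^2-X^3)\to B$ with $X\mapsto x$, $Y\mapsto y$; and $A$ is free, and in particular faithfully flat, as a left $B$-module. -/

import Mathlib

open scoped TensorProduct

namespace NodalCubic

universe u v

/-- A Hopf algebra structure on a given associative unital `R`-algebra `A`: coproduct and counit
are algebra homomorphisms that are coassociative and counital, and the antipode is the
convolution inverse of the identity. This is the data and the laws of `HopfAlgebra R A`, with the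
algebra structure on `A` fixed in advance. -/
structure HopfStructure (R : Type u) (A : Type v) [CommRing R] [Ring A] [Algebra R A] where
  /-- The coproduct. -/
  comul : A →ₐ[R] A ⊗[R] A
  /-- The counit. -/
  counit : A →ₐ[R] R
  /-- The antipode. -/
  antipode : A →ₗ[R] A
  coassoc : (Algebra.TensorProduct.assoc R R R A A A).toAlgHom.comp
      ((Algebra.TensorProduct.map comul (.id R A)).comp comul)
      = (Algebra.TensorProduct.map (.id R A) comul).comp comul
  counit_left : (Algebra.TensorProduct.map counit (.id R A)).comp comul
      = (Algebra.TensorProduct.lid R A).symm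
  counit_right : (Algebra.TensorProduct.map (.id R A) counit).comp comul
      = (Algebra.TensorProduct.rid R R A).symm
  antipode_left : LinearMap.mul' R A ∘ₗ antipode.rTensor A ∘ₗ comul.toLinearMap
      = Algebra.linearMap R A ∘ₗ counit.toLinearMap
  antipode_right : LinearMap.mul' R A ∘ₗ antipode.lTensor A ∘ₗ comul.toLinearMap
      = Algebra.linearMap R A ∘ₗ counit.toLinearMap

/-- The corresponding Hopf algebra in the sense of Mathlib. -/
abbrev HopfStructure.toHopfAlgebra {R : Type u} {A : Type v} [CommRing R] [Ring A] [Algebra R A]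
    (H : HopfStructure R A) : HopfAlgebra R A where
  __ := Bialgebra.ofAlgHom H.comul H.counit H.coassoc H.counit_left H.counit_right
  antipode := H.antipode
  mul_antipode_rTensor_comul := H.antipode_left
  mul_antipode_lTensor_comul := H.antipode_right

/-- `B` is a right coideal: the coproduct maps it into (the image of) `B ⊗ A`. -/
def HopfStructure.IsRightCoideal {R : Type u} {A : Type v} [CommRing R] [Ring A] [Algebra R A]
    (H : HopfStructure R A) (B : Subalgebra R A) : Prop :=
  ∀ f ∈ B, H.comul f ∈ LinearMap.range (B.toSubmodule.subtype.rTensor A)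

/-- The symbols `x, y, a, a⁻¹, b`. -/
inductive Gen : Type
  | x | y | a | ainv | b

/-- The coordinate ring `k[X, Y] / (Y² - X² - X³)` of the nodal cubic, with `X = X 0`, `Y = X 1`. -/
abbrev CoordRing (k : Type u) [Field k] : Type u :=
  MvPolynomial (Fin 2) k ⧸ Ideal.span
    {(MvPolynomial.X 1 ^ 2 - MvPolynomial.X 0 ^ 2 - MvPolynomial.X 0 ^ 3 :
      MvPolynomial (Fin 2) k)}

section

variable {k : Type u} [Field k] (q p : k)

/-- A symbol as an element of the free associative unital algebra. -/
abbrev g (s : Gen) : FreeAlgebra k Gen := FreeAlgebra.ι k s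

/-- A scalar as an element of the free associative unital algebra. -/
abbrev sc (c : k) : FreeAlgebra k Gen := algebraMap k (FreeAlgebra k Gen) c

open Gen in
/-- The defining relations of the algebra `A`. -/
inductive Rel : FreeAlgebra k Gen → FreeAlgebra k Gen → Prop
  | a_ainv : Rel (g a * g ainv) 1
  | ainv_a : Rel (g ainv * g a) 1
  | cubic : Rel (g y ^ 2) (g x ^ 2 + g x ^ 3)
  | b_sq : Rel (g b ^ 2) (g a ^ 3)
  | ba : Rel (g b * g a) (g a * g b)
  | ya : Rel (g y * g a) (g a * g y)
  | bx : Rel (g b * g x) (g x * g b)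
  | yx : Rel (g y * g x) (g x * g y)
  | by' : Rel (g b * g y) (-(g y * g b) + sc (2 * p) * g b ^ 2)
  | aax : Rel (g a ^ 2 * g x)
      (-(g x * g a ^ 2) - g a * g x * g a - g a ^ 2 + sc (1 + 3 * q) * g a ^ 3)
  | axx : Rel (g a * g x ^ 2)
      (-(g a * g x) - g x * g a - g x ^ 2 * g a - g x * g a * g x
        + sc ((2 + 3 * q) * q) * g a ^ 3)

/-- The unital associative `k`-algebra `A` with generators `x, y, a, a⁻¹, b` and the relations
`Rel q p`. -/
def A : Type u := RingQuot (Rel q p)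

noncomputable instance : Ring (A q p) := inferInstanceAs (Ring (RingQuot (Rel q p)))

noncomputable instance : Algebra k (A q p) := inferInstanceAs (Algebra k (RingQuot (Rel q p)))

/-- The canonical projection from the free algebra onto `A`. -/
noncomputable def proj : FreeAlgebra k Gen →ₐ[k] A q p := RingQuot.mkAlgHom k (Rel q p)

variable {q p} in
theorem proj_rel {r s : FreeAlgebra k Gen} (h : Rel q p r s) : proj q p r = proj q p s :=
  RingQuot.mkAlgHom_rel k h

/-- The generator `x` of `A`. -/
noncomputable def x : A q p := proj q p (g Gen.x)

/-- The generator `y` of `A`. -/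
noncomputable def y : A q p := proj q p (g Gen.y)

/-- The generator `a` of `A`, as a unit whose inverse is the generator `a⁻¹`. -/
noncomputable def a : (A q p)ˣ where
  val := proj q p (g Gen.a)
  inv := proj q p (g Gen.ainv)
  val_inv := by simpa using proj_rel (Rel.a_ainv (q := q) (p := p))
  inv_val := by simpa using proj_rel (Rel.ainv_a (q := q) (p := p))

theorem b_sq : proj q p (g Gen.b) ^ 2 = (a q p : A q p) ^ 3 := by
  have h := proj_rel (Rel.b_sq (q := q) (p := p))
  rwa [map_pow, map_pow] at h

theorem b_comm_a : Commute (proj q p (g Gen.b)) (a q p : A q p) := by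
  have h := proj_rel (Rel.ba (q := q) (p := p))
  rwa [map_mul, map_mul] at h

/-- The generator `b` of `A`, which is a unit with inverse `b a⁻³` as `b² = a³`. -/
noncomputable def b : (A q p)ˣ where
  val := proj q p (g Gen.b)
  inv := proj q p (g Gen.b) * ((a q p)⁻¹ ^ 3 : (A q p)ˣ)
  val_inv := by
    rw [← mul_assoc, ← pow_two, b_sq, ← Units.val_pow_eq_pow_val, ← Units.val_mul]
    simp
  inv_val := by
    have h : Commute (proj q p (g Gen.b)) (((a q p)⁻¹ ^ 3 : (A q p)ˣ) : A q p) := by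
      rw [Units.val_pow_eq_pow_val]
      exact ((b_comm_a q p).units_inv_right).pow_right 3
    rw [mul_assoc, ← h.eq, ← mul_assoc, ← pow_two, b_sq, ← Units.val_pow_eq_pow_val,
      ← Units.val_mul]
    simp

/-- The subalgebra `B` of `A` generated by `x` and `y`. -/
noncomputable def B : Subalgebra k (A q p) := Algebra.adjoin k {x q p, y q p}

theorem x_mem : x q p ∈ B q p := Algebra.subset_adjoin (by simp)

theorem y_mem : y q p ∈ B q p := Algebra.subset_adjoin (by simp)

theorem y_mul_x : y q p * x q p = x q p * y q p := by
  have h := proj_rel (Rel.yx (q := q) (p := p))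
  rwa [map_mul, map_mul] at h

/-- `B` is commutative since its generators commute. -/
instance : IsMulCommutative (B q p) :=
  Algebra.isMulCommutative_adjoin k (s := {x q p, y q p}) (by
    rintro r (rfl | rfl) s (rfl | rfl)
    · rfl
    · exact (y_mul_x q p).symm
    · exact y_mul_x q p
    · rfl)

open scoped IsMulCommutative in
/-- `B` as a commutative ring, with its ring structure as a subalgebra of `A`. -/
noncomputable instance : CommRing (B q p) := inferInstance

end

end NodalCubic

/-! Replacing `x`, `y` by `t = x + 1/3 - (q + 1/3) a` and `z = y - p b` removes `q` and `p` from the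
relations: the shift by `1/3` depresses the cubic, and the subtracted multiples of `a` and `b` make
`t` and `z` skew-primitive. The resulting relations are `SkewRel`, and tuples satisfying them in `S`
yield algebra maps from `A` to `S` (`SkewRel.lift`).

The Hopf structure then comes from the universal property. `SkewRel` is inherited by the coproduct
tuple in `S ⊗ S` (`SkewRel.tmul`), by the counit tuple in `k`, and by the antipode tuple in the
opposite algebra (`SkewRel.op`). The Hopf axioms need only be checked on generators.

For freeness, let `ω` be a primitive cube root of unity and `β = b a⁻¹`, so that `β² = a` and `β³ =
b`. The relation `aat` says that conjugation `σ` by `a` satisfies `1 + σ + σ² = 0` at `t`. Hence `t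
= e + f` with `β e = ω² e β` and `β f = ω f β`, and `att` becomes `e f = ω² f e + c (1 - β⁴)`. The
monomials `e ^ j β ^ n`, with `j` natural and `n` an integer, form a `B`-basis of `A`.

They span because their `B`-span is stable under right multiplication by the generators
(`monomSpan_eq_top`). They are independent because `A` acts on two copies of a space with basis `f ^
i e ^ j β ^ n`: there `x` has leading term `f`, which gives freeness over `k[x]`, while `z`
exchanges the copies up to the operator `d = z²`, which separates `k[x]` from `y k[x]`
(`monom_independent`). The same independence shows that `x`, `y` satisfy no relation beyond the
cubic. Free and nonzero then gives faithfully flat. -/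

namespace NodalCubic

/-! ### Presentation of `A` by skew-primitive generators -/

/-- The relations of `A` in terms of the generators `a`, `b` and the skew-primitive elements
`t = x + 1/3 - (q + 1/3) a` and `z = y - p b`; they do not involve `q` and `p`. -/
structure SkewRel (k : Type*) {S : Type*} [Field k] [Ring S] [Algebra k S] (a a' b t z : S) :
    Prop where
  a_inv : a * a' = 1
  inv_a : a' * a = 1
  bb : b * b = a * a * a
  ba : b * a = a * b
  za : z * a = a * z
  bt : b * t = t * b
  zt : z * t = t * z
  bz : b * z = -(z * b)
  aat : a * a * t + a * t * a + t * a * a = 0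
  att : a * t * t + t * a * t + t * t * a = (1 / 3 : k) • (a - a * a * a)
  zz : z * z = t * t * t - (1 / 3 : k) • t + (2 / 27 : k) • (1 - a * a * a)

section

variable {k : Type*} [Field k] [CharZero k] {S : Type*} [Ring S] [Algebra k S]

/-- The images of the generators of `A` attached to a tuple satisfying the relations `SkewRel`. -/
def genMap (q p : k) (a a' b t z : S) : Gen → S
  | .x => t - (1 / 3 : k) • 1 + (q + 1 / 3) • a
  | .y => z + p • b
  | .a => a
  | .ainv => a'
  | .b => b

/-- With `r = q + 1/3`, expanding `x² + x³` in `t` and `a` groups the mixed terms into `r • att` and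
`r² • aat`. What remains to match is the coefficient of `a³`, where `p² = q² + q³ = r³ - r/3 + 2/27`
enters. -/
theorem SkewRel.lift_rel {a a' b t z : S} (h : SkewRel k a a' b t z) {q p : k}
    (hqp : p ^ 2 = q ^ 2 + q ^ 3) ⦃u v : FreeAlgebra k Gen⦄ (huv : Rel q p u v) :
    FreeAlgebra.lift k (genMap q p a a' b t z) u
      = FreeAlgebra.lift k (genMap q p a a' b t z) v := by
  induction huv with
  | a_ainv => simpa [genMap] using h.a_inv
  | ainv_a => simpa [genMap] using h.inv_a
  | cubic =>
    have hp : (p ^ 2) • (a * a * a) = (q ^ 2 + q ^ 3) • (a * a * a) := by rw [hqp]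
    simp only [map_pow, map_add, FreeAlgebra.lift_ι_apply, genMap]
    linear_combination (norm := skip) h.zz + p • h.bz + p ^ 2 • h.bb - (q + 1 / 3) • h.att
      - (q + 1 / 3) ^ 2 • h.aat + hp
    simp only [mul_add, add_mul, mul_sub, sub_mul, smul_mul_assoc, mul_smul_comm, smul_add,
      smul_sub, smul_smul, mul_assoc, mul_one, one_mul, pow_succ, pow_zero]
    match_scalars <;> field_simp <;> ring
  | b_sq => simpa [genMap, pow_succ] using h.bb
  | ba => simpa [genMap] using h.ba
  | ya => simp [genMap, add_mul, mul_add, h.za, h.ba]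
  | bx => simp [genMap, add_mul, mul_add, sub_mul, mul_sub, h.bt, h.ba]
  | yx =>
    simp [genMap, add_mul, mul_add, sub_mul, mul_sub, h.bt, h.ba, h.zt, h.za]
    module
  | by' =>
    simp [genMap, add_mul, mul_add, h.bz, Algebra.algebraMap_eq_smul_one, pow_two]
    module
  | aax =>
    simp only [map_mul, map_pow, map_add, map_sub, map_neg, FreeAlgebra.lift_ι_apply, genMap,
      AlgHom.commutes]
    simp only [Algebra.algebraMap_eq_smul_one]
    linear_combination (norm := skip) h.aat
    simp only [mul_add, add_mul, mul_sub, sub_mul, smul_mul_assoc, mul_smul_comm, smul_add,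
      smul_sub, smul_smul, mul_assoc, mul_one, one_mul, pow_succ, pow_zero]
    match_scalars <;> field_simp <;> ring
  | axx =>
    simp only [map_mul, map_pow, map_add, map_sub, map_neg, FreeAlgebra.lift_ι_apply, genMap,
      AlgHom.commutes]
    simp only [Algebra.algebraMap_eq_smul_one]
    linear_combination (norm := skip) h.att + (2 * (q + 1 / 3)) • h.aat
    simp only [mul_add, add_mul, mul_sub, sub_mul, smul_mul_assoc, mul_smul_comm, smul_add,
      smul_sub, smul_smul, mul_assoc, mul_one, one_mul, pow_succ, pow_zero]
    match_scalars <;> field_simp <;> ring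

/-- The algebra homomorphism out of `A` attached to a tuple satisfying the relations `SkewRel`. -/
noncomputable def SkewRel.lift {a a' b t z : S} (h : SkewRel k a a' b t z) {q p : k}
    (hqp : p ^ 2 = q ^ 2 + q ^ 3) : A q p →ₐ[k] S :=
  RingQuot.liftAlgHom k ⟨FreeAlgebra.lift k (genMap q p a a' b t z), h.lift_rel hqp⟩

theorem SkewRel.lift_proj {a a' b t z : S} (h : SkewRel k a a' b t z) {q p : k}
    (hqp : p ^ 2 = q ^ 2 + q ^ 3) (s : Gen) :
    h.lift hqp (proj q p (g s)) = genMap q p a a' b t z s := by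
  refine (RingQuot.liftAlgHom_mkAlgHom_apply k _ (h.lift_rel hqp) _).trans ?_
  simp

section

variable (q p : k)

/-- The skew-primitive element `x + 1/3 - (q + 1/3) a`. -/
noncomputable def t : A q p := x q p + (1 / 3 : k) • 1 - (q + 1 / 3) • (a q p : A q p)

/-- The skew-primitive element `y - p b`. -/
noncomputable def z : A q p := y q p - p • (b q p : A q p)

theorem x_eq : x q p = t q p - (1 / 3 : k) • 1 + (q + 1 / 3) • (a q p : A q p) := by
  simp only [t]
  module

theorem y_eq : y q p = z q p + p • (b q p : A q p) := by simp [z]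

theorem b_mul_a : (b q p * a q p : A q p) = a q p * b q p := b_comm_a q p

theorem y_mul_a : (y q p * a q p : A q p) = a q p * y q p := by
  have := proj_rel (Rel.ya (q := q) (p := p))
  rwa [map_mul, map_mul] at this

theorem b_mul_x : (b q p * x q p : A q p) = x q p * b q p := by
  have := proj_rel (Rel.bx (q := q) (p := p))
  rwa [map_mul, map_mul] at this

theorem b_mul_b : (b q p * b q p : A q p) = a q p * a q p * a q p := by
  have := b_sq q p
  rw [pow_two, pow_succ, pow_two] at this
  exact this

theorem b_mul_y : (b q p * y q p : A q p) = -(y q p * b q p) + (2 * p) • (b q p * b q p) := by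
  have := proj_rel (Rel.by' (q := q) (p := p))
  rw [map_add, map_neg, map_mul, map_mul, map_mul, AlgHom.commutes, ← Algebra.smul_def, pow_two,
    map_mul] at this
  exact this

theorem y_mul_y : y q p * y q p = x q p * x q p + x q p * x q p * x q p := by
  have := proj_rel (Rel.cubic (q := q) (p := p))
  simp only [pow_succ, pow_zero, one_mul, map_add, map_mul] at this
  exact this

theorem a_mul_a_mul_x : (a q p * a q p * x q p : A q p) =
    -(x q p * a q p * a q p) - a q p * x q p * a q p - a q p * a q p
      + (1 + 3 * q) • (a q p * a q p * a q p) := by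
  have := proj_rel (Rel.aax (q := q) (p := p))
  rw [map_add, map_mul _ (sc _), AlgHom.commutes, ← Algebra.smul_def] at this
  simp only [map_mul, map_sub, map_neg, pow_succ, pow_zero, one_mul, ← mul_assoc] at this
  exact this

theorem a_mul_x_mul_x : (a q p * x q p * x q p : A q p) =
    -(a q p * x q p) - x q p * a q p - x q p * x q p * a q p - x q p * a q p * x q p
      + ((2 + 3 * q) * q) • (a q p * a q p * a q p) := by
  have := proj_rel (Rel.axx (q := q) (p := p))
  rw [map_add, map_mul _ (sc _), AlgHom.commutes, ← Algebra.smul_def] at this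
  simp only [map_mul, map_sub, map_neg, pow_succ, pow_zero, one_mul, ← mul_assoc] at this
  exact this

variable {q p} in
theorem skewRel (hqp : p ^ 2 = q ^ 2 + q ^ 3) :
    SkewRel k (a q p : A q p) ((a q p)⁻¹ : (A q p)ˣ) (b q p) (t q p) (z q p) := by
  have hbx := b_mul_x q p
  have hba := b_mul_a q p
  have hya := y_mul_a q p
  have hyx := y_mul_x q p
  have haax : (a q p * a q p * t q p + a q p * t q p * a q p + t q p * a q p * a q p : A q p)
      = 0 := by
    have := a_mul_a_mul_x q p
    rw [x_eq] at this
    linear_combination (norm := skip) this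
    simp only [mul_add, add_mul, mul_sub, sub_mul, smul_mul_assoc, mul_smul_comm, smul_add,
      smul_sub, smul_smul, mul_assoc, mul_one, one_mul]
    match_scalars <;> field_simp <;> ring
  have haxx : (a q p * t q p * t q p + t q p * a q p * t q p + t q p * t q p * a q p : A q p)
      = (1 / 3 : k) • (a q p - a q p * a q p * a q p : A q p) := by
    have := a_mul_x_mul_x q p
    rw [x_eq] at this
    linear_combination (norm := skip) this - (2 * (q + 1 / 3)) • haax
    simp only [mul_add, add_mul, mul_sub, sub_mul, smul_mul_assoc, mul_smul_comm, smul_add,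
      smul_sub, smul_smul, mul_assoc, mul_one, one_mul]
    match_scalars <;> field_simp <;> ring
  have hbz : (b q p * z q p : A q p) = -(z q p * b q p) := by
    simp only [z, mul_sub, sub_mul, b_mul_y, mul_smul_comm, smul_mul_assoc]
    module
  refine ⟨by simp, by simp, b_mul_b q p, hba, ?_, ?_, ?_, hbz, haax, haxx, ?_⟩
  · simp [z, sub_mul, mul_sub, hya, hba]
  · simp [t, add_mul, mul_add, sub_mul, mul_sub, hbx, hba]
  · simp only [z, t, add_mul, mul_add, sub_mul, mul_sub, hbx, hba, hya, hyx, smul_mul_assoc,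
      mul_smul_comm, one_mul, mul_one]
    module
  · have hy := y_mul_y q p
    have hbb := b_mul_b q p
    have hp : (p ^ 2) • (a q p * a q p * a q p : A q p)
        = (q ^ 2 + q ^ 3) • (a q p * a q p * a q p : A q p) := by rw [hqp]
    rw [x_eq, y_eq] at hy
    linear_combination (norm := skip) hy - p • hbz - p ^ 2 • hbb + (q + 1 / 3) • haxx
      + (q + 1 / 3) ^ 2 • haax - hp
    simp only [mul_add, add_mul, mul_sub, sub_mul, smul_mul_assoc, mul_smul_comm, smul_add,
      smul_sub, smul_smul, mul_assoc, mul_one, one_mul]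
    match_scalars <;> field_simp <;> ring

end

variable {q p : k}

theorem SkewRel.lift_a {a' a'' b' t' z' : S} (h : SkewRel k a' a'' b' t' z')
    (hqp : p ^ 2 = q ^ 2 + q ^ 3) : h.lift hqp (a q p : A q p) = a' := h.lift_proj hqp .a

theorem SkewRel.lift_a_inv {a' a'' b' t' z' : S} (h : SkewRel k a' a'' b' t' z')
    (hqp : p ^ 2 = q ^ 2 + q ^ 3) :
    h.lift hqp (((a q p)⁻¹ : (A q p)ˣ) : A q p) = a'' := h.lift_proj hqp .ainv

theorem SkewRel.lift_b {a' a'' b' t' z' : S} (h : SkewRel k a' a'' b' t' z')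
    (hqp : p ^ 2 = q ^ 2 + q ^ 3) : h.lift hqp (b q p : A q p) = b' := h.lift_proj hqp .b

theorem SkewRel.lift_x {a' a'' b' t' z' : S} (h : SkewRel k a' a'' b' t' z')
    (hqp : p ^ 2 = q ^ 2 + q ^ 3) :
    h.lift hqp (x q p) = t' - (1 / 3 : k) • 1 + (q + 1 / 3) • a' := h.lift_proj hqp .x

theorem SkewRel.lift_y {a' a'' b' t' z' : S} (h : SkewRel k a' a'' b' t' z')
    (hqp : p ^ 2 = q ^ 2 + q ^ 3) : h.lift hqp (y q p) = z' + p • b' := h.lift_proj hqp .y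

theorem SkewRel.lift_t {a' a'' b' t' z' : S} (h : SkewRel k a' a'' b' t' z')
    (hqp : p ^ 2 = q ^ 2 + q ^ 3) : h.lift hqp (t q p) = t' := by
  simp only [t, map_add, map_sub, map_smul, map_one, h.lift_a, h.lift_x]
  module

theorem SkewRel.lift_z {a' a'' b' t' z' : S} (h : SkewRel k a' a'' b' t' z')
    (hqp : p ^ 2 = q ^ 2 + q ^ 3) : h.lift hqp (z q p) = z' := by
  simp [z, h.lift_b, h.lift_y]

theorem proj_surjective (q p : k) : Function.Surjective (proj q p) :=
  RingQuot.mkAlgHom_surjective k _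

/-- A subalgebra of `A` containing `t`, `z`, `a`, `a⁻¹` and `b` is everything. -/
theorem subalgebra_eq_top {T : Subalgebra k (A q p)} (ht : t q p ∈ T) (hz : z q p ∈ T)
    (ha : (a q p : A q p) ∈ T) (ha' : (((a q p)⁻¹ : (A q p)ˣ) : A q p) ∈ T)
    (hb : (b q p : A q p) ∈ T) : T = ⊤ := by
  rw [eq_top_iff]
  rintro u -
  obtain ⟨w, rfl⟩ := proj_surjective q p u
  induction w using FreeAlgebra.induction with
  | grade0 c => rw [AlgHom.commutes]; exact T.algebraMap_mem c
  | grade1 s =>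
    cases s with
    | x =>
      change x q p ∈ T
      rw [x_eq]
      exact T.add_mem (T.sub_mem ht (T.smul_mem T.one_mem _)) (T.smul_mem ha _)
    | y =>
      change y q p ∈ T
      rw [y_eq]
      exact T.add_mem hz (T.smul_mem hb _)
    | a => exact ha
    | ainv => exact ha'
    | b => exact hb
  | mul u v hu hv => rw [map_mul]; exact T.mul_mem hu hv
  | add u v hu hv => rw [map_add]; exact T.add_mem hu hv

/-- The value at `a⁻¹` need not be compared, since an algebra map preserves inverses of units. -/
theorem algHom_ext_skew {f h : A q p →ₐ[k] S} (ht : f (t q p) = h (t q p))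
    (hz : f (z q p) = h (z q p)) (ha : f (a q p) = h (a q p)) (hb : f (b q p) = h (b q p)) :
    f = h := by
  have hu : Units.map (f : A q p →* S) (a q p) = Units.map (h : A q p →* S) (a q p) :=
    Units.ext ha
  have ha' : f ((a q p)⁻¹ : (A q p)ˣ) = h ((a q p)⁻¹ : (A q p)ˣ) := by
    have := congrArg (fun w : Sˣ => ((w⁻¹ : Sˣ) : S)) hu
    simp only [← map_inv] at this
    exact this
  have := subalgebra_eq_top (T := AlgHom.equalizer f h) ht hz ha ha' hb
  ext w
  exact (this ▸ Algebra.mem_top : w ∈ AlgHom.equalizer f h)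

end

/-! ### Compatibility of the relations with coproduct, counit and antipode -/

section

variable {k : Type*} [Field k] {S : Type*} [Ring S] [Algebra k S]

/-- Each relation expands into its copies on the two tensor factors plus mixed terms. The mixed
terms of `att` are multiples of `aat`. Those of `zz` are `t ⊗ att` and `t² ⊗ aat`, while `z ⊗ (b z +
z b)` vanishes. -/
theorem SkewRel.tmul {a a' b t z : S} (h : SkewRel k a a' b t z) :
    SkewRel k (a ⊗ₜ[k] a) (a' ⊗ₜ[k] a') (b ⊗ₜ[k] b) (1 ⊗ₜ[k] t + t ⊗ₜ[k] a)
      (1 ⊗ₜ[k] z + z ⊗ₜ[k] b) where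
  a_inv := by simp [h.a_inv, Algebra.TensorProduct.one_def]
  inv_a := by simp [h.inv_a, Algebra.TensorProduct.one_def]
  bb := by simp [h.bb]
  ba := by simp [h.ba]
  za := by simp [mul_add, add_mul, h.za, h.ba]
  bt := by simp [mul_add, add_mul, h.bt, h.ba]
  zt := by
    simp only [mul_add, add_mul, Algebra.TensorProduct.tmul_mul_tmul, h.zt, h.za, h.bt, h.ba,
      one_mul, mul_one]
    abel
  bz := by
    simp only [mul_add, add_mul, Algebra.TensorProduct.tmul_mul_tmul, h.bz, one_mul, mul_one,
      TensorProduct.tmul_neg, TensorProduct.neg_tmul]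
    abel
  aat := by
    have h1 := congrArg (fun w => (a * a) ⊗ₜ[k] w) h.aat
    have h2 := congrArg (fun w => w ⊗ₜ[k] (a * a * a)) h.aat
    simp only [TensorProduct.tmul_add, TensorProduct.add_tmul, TensorProduct.tmul_zero,
      TensorProduct.zero_tmul] at h1 h2
    simp only [mul_add, add_mul, Algebra.TensorProduct.tmul_mul_tmul, one_mul, mul_one]
    linear_combination (norm := abel) h1 + h2
  att := by
    have h1 := congrArg (fun w => a ⊗ₜ[k] w) h.att
    have h2 := congrArg (fun w => w ⊗ₜ[k] (a * a * a)) h.att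
    have h3 := congrArg (fun w => (a * t) ⊗ₜ[k] w) h.aat
    have h4 := congrArg (fun w => (t * a) ⊗ₜ[k] w) h.aat
    simp only [TensorProduct.tmul_add, TensorProduct.add_tmul, TensorProduct.tmul_sub,
      TensorProduct.sub_tmul, TensorProduct.tmul_smul, ← TensorProduct.smul_tmul',
      TensorProduct.tmul_zero] at h1 h2 h3 h4
    simp only [mul_add, add_mul, Algebra.TensorProduct.tmul_mul_tmul, one_mul, mul_one]
    linear_combination (norm := skip) h1 + h2 + h3 + h4
    simp only [mul_assoc]
    module
  zz := by
    have h1 := congrArg (fun w => (1 : S) ⊗ₜ[k] w) h.zz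
    have h2 := congrArg (fun w => w ⊗ₜ[k] (a * a * a)) h.zz
    have h3 := congrArg (fun w => t ⊗ₜ[k] w) h.att
    have h4 := congrArg (fun w => (t * t) ⊗ₜ[k] w) h.aat
    simp only [TensorProduct.tmul_add, TensorProduct.add_tmul, TensorProduct.tmul_sub,
      TensorProduct.sub_tmul, TensorProduct.tmul_smul, ← TensorProduct.smul_tmul',
      TensorProduct.tmul_zero] at h1 h2 h3 h4
    simp only [mul_add, add_mul, Algebra.TensorProduct.tmul_mul_tmul, one_mul, mul_one, h.bb,
      h.bz, TensorProduct.tmul_neg, Algebra.TensorProduct.one_def]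
    linear_combination (norm := skip) h1 + h2 - h3 - h4
    simp only [mul_assoc]
    module

theorem SkewRel.counit : SkewRel k (1 : k) 1 1 0 0 := by
  constructor <;> simp

-- The tuple is the expected antipode `a⁻¹`, `a`, `b⁻¹`, `-t a⁻¹`, `-z b⁻¹`. The auxiliary
-- identities move powers of `a⁻¹` to the right: `k1` is `aat` divided by `a³`, `k2` says that `a⁻³`
-- commutes with `t` because `1 + σ + σ² = 0` forces `σ³ = 1`, and `k3`, `k4` normalise words with
-- two letters `t`.
open MulOpposite in
theorem SkewRel.op {a b : Sˣ} {t z : S} (h : SkewRel k (a : S) (a⁻¹ : Sˣ) b t z) :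
    SkewRel k (op ((a⁻¹ : Sˣ) : S)) (op (a : S)) (op ((b⁻¹ : Sˣ) : S))
      (op (-(t * (a⁻¹ : Sˣ)))) (op (-(z * (b⁻¹ : Sˣ)))) := by
  have hba : Commute (b : S) a := h.ba
  have hza : Commute z (a : S) := h.za
  have hbt : Commute (b : S) t := h.bt
  have hzt : Commute z t := h.zt
  have hab' : Commute ((a⁻¹ : Sˣ) : S) (b⁻¹ : Sˣ) :=
    (hba.units_inv_left.units_inv_right).symm
  have hza' : Commute z (a⁻¹ : Sˣ) := hza.units_inv_right
  have hb't : Commute ((b⁻¹ : Sˣ) : S) t := hbt.units_inv_left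
  have hbb : ((b⁻¹ : Sˣ) : S) * (b⁻¹ : Sˣ) = (a⁻¹ : Sˣ) * (a⁻¹ : Sˣ) * (a⁻¹ : Sˣ) := by
    have : b * b = a * a * a := Units.ext h.bb
    have := congrArg (fun w : Sˣ => ((w⁻¹ : Sˣ) : S)) this
    simpa only [mul_inv_rev, Units.val_mul, mul_assoc] using this
  have hb'z : ((b⁻¹ : Sˣ) : S) * z = -(z * (b⁻¹ : Sˣ)) := by
    have := congrArg (fun w => ((b⁻¹ : Sˣ) : S) * w * (b⁻¹ : Sˣ)) h.bz
    simp only [mul_assoc, mul_neg, neg_mul, Units.inv_mul_cancel_left, Units.mul_inv,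
      mul_one] at this
    rw [this, neg_neg]
  have k1 : (a * t * (a⁻¹ : Sˣ) * (a⁻¹ : Sˣ) + t * (a⁻¹ : Sˣ) + (a⁻¹ : Sˣ) * t : S) = 0 := by
    have := congrArg (fun w => ((a⁻¹ : Sˣ) : S) * w * (a⁻¹ : Sˣ) * (a⁻¹ : Sˣ)) h.aat
    simpa [mul_add, add_mul, mul_assoc] using this
  have k2 : ((a⁻¹ : Sˣ) * (a⁻¹ : Sˣ) * (a⁻¹ : Sˣ) * t : S)
      = t * (a⁻¹ : Sˣ) * (a⁻¹ : Sˣ) * (a⁻¹ : Sˣ) := by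
    linear_combination (norm := skip) ((a⁻¹ : Sˣ) : S) * (a⁻¹ : Sˣ) * k1 - (a⁻¹ : Sˣ) * k1 * (a⁻¹ : Sˣ)
    simp only [mul_add, add_mul, mul_assoc, Units.inv_mul_cancel_left, mul_zero, zero_mul]
    abel
  have k4 : (t * (a⁻¹ : Sˣ) * (a⁻¹ : Sˣ) * t * (a⁻¹ : Sˣ) : S)
      = t * a * t * ((a⁻¹ : Sˣ) * (a⁻¹ : Sˣ) * (a⁻¹ : Sˣ) * (a⁻¹ : Sˣ)) := by
    linear_combination (norm := skip) t * ((a⁻¹ : Sˣ) * k1) * (a⁻¹ : Sˣ)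
      - t * k1 * ((a⁻¹ : Sˣ) * (a⁻¹ : Sˣ))
    simp only [mul_add, add_mul, mul_assoc, Units.inv_mul_cancel_left, mul_zero, zero_mul]
    abel
  have k3 : ((a⁻¹ : Sˣ) * t * (a⁻¹ : Sˣ) * t * (a⁻¹ : Sˣ) : S)
      = t * t * ((a⁻¹ : Sˣ) * (a⁻¹ : Sˣ) * (a⁻¹ : Sˣ))
        - (1 / 3 : k) • (((a⁻¹ : Sˣ) * (a⁻¹ : Sˣ) * (a⁻¹ : Sˣ) : S) - (a⁻¹ : Sˣ)) := by
    have e := h.att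
    linear_combination (norm := skip) k1 * ((a⁻¹ : Sˣ) * t * (a⁻¹ : Sˣ)) - k4
      - a * t * k2 * (a⁻¹ : Sˣ)
      - e * ((a⁻¹ : Sˣ) * (a⁻¹ : Sˣ) * (a⁻¹ : Sˣ) * (a⁻¹ : Sˣ) : S)
    simp only [mul_add, add_mul, sub_mul, mul_assoc, Units.inv_mul_cancel_left,
      Units.mul_inv_cancel_left, mul_zero, zero_mul, smul_mul_assoc]
    module
  constructor
  · rw [← op_mul]; simp
  · rw [← op_mul]; simp
  · simp only [← op_mul, hbb, mul_assoc]
  · simp only [← op_mul, hab'.eq]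
  · simp only [← op_mul]
    congr 1
    rw [mul_neg, neg_mul, ← mul_assoc, ← hza'.eq, mul_assoc, hab'.eq, mul_assoc]
  · simp only [← op_mul]
    congr 1
    rw [mul_neg, neg_mul, ← mul_assoc, hb't.eq, mul_assoc, hab'.eq, mul_assoc]
  · simp only [← op_mul]
    congr 1
    rw [neg_mul_neg, neg_mul_neg]
    calc t * (a⁻¹ : Sˣ) * (z * (b⁻¹ : Sˣ)) = t * ((a⁻¹ : Sˣ) * z) * (b⁻¹ : Sˣ) := by
          simp only [mul_assoc]
      _ = (t * z) * ((a⁻¹ : Sˣ) * (b⁻¹ : Sˣ)) := by rw [← hza'.eq]; simp only [mul_assoc]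
      _ = z * (t * (b⁻¹ : Sˣ)) * (a⁻¹ : Sˣ) := by
          rw [← hzt.eq, hab'.eq]; simp only [mul_assoc]
      _ = z * (b⁻¹ : Sˣ) * (t * (a⁻¹ : Sˣ)) := by rw [← hb't.eq]; simp only [mul_assoc]
  · simp only [← op_mul, ← op_neg]
    congr 1
    rw [mul_neg, ← mul_assoc, hb'z, neg_mul, neg_neg]
  · simp only [← op_mul, ← op_add]
    rw [op_eq_zero_iff]
    linear_combination (norm := skip) -((a⁻¹ : Sˣ) : S) * (a⁻¹ : Sˣ) * h.aat * (a⁻¹ : Sˣ) * (a⁻¹ : Sˣ) * (a⁻¹ : Sˣ)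
    simp only [mul_add, add_mul, sub_mul, mul_assoc, Units.inv_mul_cancel_left,
      Units.mul_inv_cancel_left, Units.mul_inv, Units.inv_mul, mul_one, mul_zero, zero_mul,
      smul_mul_assoc, neg_mul, mul_neg]
    abel
  · simp only [← op_mul, ← op_add, ← op_sub, ← op_smul]
    congr 1
    linear_combination (norm := skip) k3 + k4 + t * k1 * (a⁻¹ : Sˣ) * (a⁻¹ : Sˣ)
    simp only [mul_add, add_mul, mul_sub, sub_mul, mul_assoc, mul_zero, zero_mul,
      smul_mul_assoc, mul_smul_comm, neg_mul, mul_neg, one_mul]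
    module
  · simp only [← op_mul, ← op_add, ← op_sub, ← op_smul, ← op_one]
    congr 1
    have e : z * (b⁻¹ : Sˣ) * (z * (b⁻¹ : Sˣ))
        = -(z * z * ((a⁻¹ : Sˣ) * (a⁻¹ : Sˣ) * (a⁻¹ : Sˣ))) := by
      rw [← hbb, mul_assoc, ← mul_assoc _ z, hb'z]
      simp only [neg_mul, mul_neg, mul_assoc]
    rw [neg_mul_neg, e, h.zz]
    linear_combination (norm := skip) t * k3
    simp only [mul_add, add_mul, mul_sub, sub_mul, mul_assoc, Units.inv_mul_cancel_left,
      Units.mul_inv_cancel_left, Units.mul_inv, Units.inv_mul, mul_one, mul_zero, zero_mul,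
      smul_mul_assoc, mul_smul_comm, neg_mul, mul_neg, one_mul]
    module

end

/-! ### The Hopf algebra structure and the coideal property -/

/-- Multiplicativity of the left antipode law: it suffices to check it on generators. -/
theorem mul_rTensor_mul {k : Type*} [Field k] {S : Type*} [Ring S] [Algebra k S]
    (s : S →ₐ[k] Sᵐᵒᵖ) (σ : S →ₗ[k] S) (hσ : ∀ u, σ u = (s u).unop) {u : S ⊗[k] S} {c : k}
    (hu : LinearMap.mul' k S (σ.rTensor S u) = algebraMap k S c) (v : S ⊗[k] S) :
    LinearMap.mul' k S (σ.rTensor S (u * v))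
      = algebraMap k S c * LinearMap.mul' k S (σ.rTensor S v) := by
  induction v with
  | zero => simp
  | add v w hv hw => simp only [mul_add, map_add, hv, hw]
  | tmul v w =>
    have key : LinearMap.mul' k S (σ.rTensor S (u * v ⊗ₜ[k] w))
        = σ v * LinearMap.mul' k S (σ.rTensor S u) * w := by
      clear hu
      induction u with
      | zero => simp
      | add u u' hu hu' => simp only [add_mul, mul_add, map_add, hu, hu']
      | tmul u u' => simp [hσ, mul_assoc]
    rw [key, hu]
    simp [← Algebra.commutes c, mul_assoc]

/-- Multiplicativity of the right antipode law. -/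
theorem mul_lTensor_mul {k : Type*} [Field k] {S : Type*} [Ring S] [Algebra k S]
    (s : S →ₐ[k] Sᵐᵒᵖ) (σ : S →ₗ[k] S) (hσ : ∀ u, σ u = (s u).unop) (u : S ⊗[k] S)
    {v : S ⊗[k] S} {c : k}
    (hv : LinearMap.mul' k S (σ.lTensor S v) = algebraMap k S c) :
    LinearMap.mul' k S (σ.lTensor S (u * v))
      = LinearMap.mul' k S (σ.lTensor S u) * algebraMap k S c := by
  induction u with
  | zero => simp
  | add v w hv hw => simp only [add_mul, map_add, hv, hw]
  | tmul u u' =>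
    have key : LinearMap.mul' k S (σ.lTensor S (u ⊗ₜ[k] u' * v))
        = u * LinearMap.mul' k S (σ.lTensor S v) * σ u' := by
      clear hv
      induction v with
      | zero => simp
      | add u u' hu hu' => simp only [add_mul, mul_add, map_add, hu, hu']
      | tmul u u' => simp [hσ, mul_assoc]
    rw [key, hv]
    simp [Algebra.commutes c, mul_assoc]

section

variable {k : Type*} [Field k] [CharZero k] {q p : k} (hqp : p ^ 2 = q ^ 2 + q ^ 3)

/-- The coproduct of `A`. -/
noncomputable def comul : A q p →ₐ[k] A q p ⊗[k] A q p := (skewRel hqp).tmul.lift hqp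

/-- The counit of `A`. -/
noncomputable def counit : A q p →ₐ[k] k := SkewRel.counit.lift hqp

/-- The antipode of `A` as an algebra homomorphism to the opposite algebra. -/
noncomputable def antipodeOp : A q p →ₐ[k] (A q p)ᵐᵒᵖ := (skewRel hqp).op.lift hqp

/-- The antipode of `A`. -/
noncomputable def antipode : A q p →ₗ[k] A q p :=
  (MulOpposite.opLinearEquiv k).symm.toLinearMap ∘ₗ (antipodeOp hqp).toLinearMap

theorem antipode_apply (u : A q p) : antipode hqp u = (antipodeOp hqp u).unop := rfl

theorem comul_t : comul hqp (t q p) = 1 ⊗ₜ t q p + t q p ⊗ₜ (a q p : A q p) :=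
  (skewRel hqp).tmul.lift_t hqp

theorem comul_z : comul hqp (z q p) = 1 ⊗ₜ z q p + z q p ⊗ₜ (b q p : A q p) :=
  (skewRel hqp).tmul.lift_z hqp

theorem comul_a : comul hqp (a q p) = (a q p : A q p) ⊗ₜ[k] (a q p : A q p) :=
  (skewRel hqp).tmul.lift_a hqp

theorem comul_b : comul hqp (b q p) = (b q p : A q p) ⊗ₜ[k] (b q p : A q p) :=
  (skewRel hqp).tmul.lift_b hqp

theorem comul_a_inv : comul hqp ((a q p)⁻¹ : (A q p)ˣ)
    = (((a q p)⁻¹ : (A q p)ˣ) : A q p) ⊗ₜ[k] (((a q p)⁻¹ : (A q p)ˣ) : A q p) :=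
  (skewRel hqp).tmul.lift_proj hqp .ainv

theorem counit_t : counit hqp (t q p) = 0 := SkewRel.counit.lift_t hqp

theorem counit_z : counit hqp (z q p) = 0 := SkewRel.counit.lift_z hqp

theorem counit_a : counit hqp (a q p) = 1 := SkewRel.counit.lift_a hqp

theorem counit_b : counit hqp (b q p) = 1 := SkewRel.counit.lift_b hqp

theorem counit_a_inv : counit hqp ((a q p)⁻¹ : (A q p)ˣ) = 1 :=
  SkewRel.counit.lift_proj hqp .ainv

theorem antipode_t : antipode hqp (t q p) = -(t q p * ((a q p)⁻¹ : (A q p)ˣ)) :=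
  congrArg MulOpposite.unop ((skewRel hqp).op.lift_t hqp)

theorem antipode_z : antipode hqp (z q p) = -(z q p * ((b q p)⁻¹ : (A q p)ˣ)) :=
  congrArg MulOpposite.unop ((skewRel hqp).op.lift_z hqp)

theorem antipode_a : antipode hqp (a q p) = ((a q p)⁻¹ : (A q p)ˣ) :=
  congrArg MulOpposite.unop ((skewRel hqp).op.lift_a hqp)

theorem antipode_b : antipode hqp (b q p) = ((b q p)⁻¹ : (A q p)ˣ) :=
  congrArg MulOpposite.unop ((skewRel hqp).op.lift_b hqp)

theorem antipode_a_inv : antipode hqp ((a q p)⁻¹ : (A q p)ˣ) = a q p :=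
  congrArg MulOpposite.unop ((skewRel hqp).op.lift_proj hqp .ainv)

theorem antipode_one : antipode hqp 1 = 1 := by simp [antipode_apply]

/-- The elements satisfying the antipode law form a subalgebra, because the antipode is
antimultiplicative and the values of the counit are central. It therefore suffices to test
generators. -/
theorem mul_antipode_rTensor_comul (u : A q p) :
    LinearMap.mul' k (A q p) ((antipode hqp).rTensor _ (comul hqp u))
      = algebraMap k _ (counit hqp u) := by
  let T : Subalgebra k (A q p) :=
    { carrier := {u | LinearMap.mul' k (A q p) ((antipode hqp).rTensor _ (comul hqp u))
        = algebraMap k _ (counit hqp u)}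
      mul_mem' := by
        intro u v hu hv
        simp only [Set.mem_ofPred_eq] at hu hv ⊢
        rw [map_mul, mul_rTensor_mul _ _ (antipode_apply hqp) hu, hv, map_mul, map_mul]
      add_mem' := by
        intro u v hu hv
        simp only [Set.mem_ofPred_eq] at hu hv ⊢
        simp only [map_add, hu, hv]
      algebraMap_mem' := by
        intro c
        simp [Algebra.algebraMap_eq_smul_one c, Algebra.TensorProduct.one_def, antipode_one] }
  have hT : T = ⊤ := by
    apply subalgebra_eq_top
    · change LinearMap.mul' k (A q p) ((antipode hqp).rTensor _ (comul hqp _)) = _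
      simp [comul_t, counit_t, antipode_t, antipode_one]
    · change LinearMap.mul' k (A q p) ((antipode hqp).rTensor _ (comul hqp _)) = _
      simp [comul_z, counit_z, antipode_z, antipode_one]
    · change LinearMap.mul' k (A q p) ((antipode hqp).rTensor _ (comul hqp _)) = _
      simp [comul_a, counit_a, antipode_a]
    · change LinearMap.mul' k (A q p) ((antipode hqp).rTensor _ (comul hqp _)) = _
      rw [comul_a_inv, counit_a_inv]
      simp [antipode_a_inv]
    · change LinearMap.mul' k (A q p) ((antipode hqp).rTensor _ (comul hqp _)) = _
      simp [comul_b, counit_b, antipode_b]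
  exact (hT ▸ Algebra.mem_top : u ∈ T)

theorem mul_antipode_lTensor_comul (u : A q p) :
    LinearMap.mul' k (A q p) ((antipode hqp).lTensor _ (comul hqp u))
      = algebraMap k _ (counit hqp u) := by
  let T : Subalgebra k (A q p) :=
    { carrier := {u | LinearMap.mul' k (A q p) ((antipode hqp).lTensor _ (comul hqp u))
        = algebraMap k _ (counit hqp u)}
      mul_mem' := by
        intro u v hu hv
        simp only [Set.mem_ofPred_eq] at hu hv ⊢
        rw [map_mul, mul_lTensor_mul _ _ (antipode_apply hqp) _ hv, hu, map_mul, map_mul]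
      add_mem' := by
        intro u v hu hv
        simp only [Set.mem_ofPred_eq] at hu hv ⊢
        simp only [map_add, hu, hv]
      algebraMap_mem' := by
        intro c
        simp [Algebra.algebraMap_eq_smul_one c, Algebra.TensorProduct.one_def, antipode_one] }
  have hT : T = ⊤ := by
    apply subalgebra_eq_top
    · change LinearMap.mul' k (A q p) ((antipode hqp).lTensor _ (comul hqp _)) = _
      simp [comul_t, counit_t, antipode_t, antipode_a]
    · change LinearMap.mul' k (A q p) ((antipode hqp).lTensor _ (comul hqp _)) = _
      simp [comul_z, counit_z, antipode_z, antipode_b]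
    · change LinearMap.mul' k (A q p) ((antipode hqp).lTensor _ (comul hqp _)) = _
      simp [comul_a, counit_a, antipode_a]
    · change LinearMap.mul' k (A q p) ((antipode hqp).lTensor _ (comul hqp _)) = _
      rw [comul_a_inv, counit_a_inv]
      simp [antipode_a_inv]
    · change LinearMap.mul' k (A q p) ((antipode hqp).lTensor _ (comul hqp _)) = _
      simp [comul_b, counit_b, antipode_b]
  exact (hT ▸ Algebra.mem_top : u ∈ T)

/-- The Hopf algebra structure of `A`. -/
noncomputable def hopfStructure : HopfStructure k (A q p) where
  comul := comul hqp
  counit := counit hqp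
  antipode := antipode hqp
  coassoc := by
    apply algHom_ext_skew
    · simp [comul_t, comul_a, TensorProduct.tmul_add, TensorProduct.add_tmul,
        Algebra.TensorProduct.one_def, add_assoc]
    · simp [comul_z, comul_b, TensorProduct.tmul_add, TensorProduct.add_tmul,
        Algebra.TensorProduct.one_def, add_assoc]
    · simp [comul_a]
    · simp [comul_b]
  counit_left := by
    apply algHom_ext_skew
    · simp [comul_t, counit_t]
    · simp [comul_z, counit_z]
    · simp [comul_a, counit_a]
    · simp [comul_b, counit_b]
  counit_right := by
    apply algHom_ext_skew
    · simp [comul_t, counit_t, counit_a]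
    · simp [comul_z, counit_z, counit_b]
    · simp [comul_a, counit_a]
    · simp [comul_b, counit_b]
  antipode_left := LinearMap.ext (mul_antipode_rTensor_comul hqp)
  antipode_right := LinearMap.ext (mul_antipode_lTensor_comul hqp)

theorem comul_x : comul hqp (x q p) =
    1 ⊗ₜ[k] (x q p - q • (a q p : A q p)) + x q p ⊗ₜ[k] (a q p : A q p) := by
  rw [x_eq]
  simp only [map_add, map_sub, map_smul, map_one, comul_t, comul_a, TensorProduct.tmul_add,
    TensorProduct.add_tmul, TensorProduct.tmul_sub, TensorProduct.sub_tmul,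
    TensorProduct.tmul_smul, ← TensorProduct.smul_tmul', Algebra.TensorProduct.one_def]
  module

theorem comul_y : comul hqp (y q p) =
    1 ⊗ₜ[k] (y q p - p • (b q p : A q p)) + y q p ⊗ₜ[k] (b q p : A q p) := by
  rw [y_eq]
  simp only [map_add, map_smul, comul_z, comul_b, TensorProduct.tmul_add,
    TensorProduct.add_tmul, TensorProduct.tmul_sub,
    TensorProduct.tmul_smul, ← TensorProduct.smul_tmul']
  module

theorem counit_x : counit hqp (x q p) = q := by
  simp [x_eq, counit_t, counit_a]

theorem counit_y : counit hqp (y q p) = p := by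
  simp [y_eq, counit_z, counit_b]

theorem antipode_x : antipode hqp (x q p) = algebraMap k (A q p) q
    - (x q p - algebraMap k (A q p) q) * ((a q p)⁻¹ : (A q p)ˣ) := by
  rw [x_eq]
  simp only [map_add, map_sub, map_smul, antipode_t, antipode_a, antipode_one, add_mul, sub_mul,
    smul_mul_assoc, Units.mul_inv, one_mul, Algebra.algebraMap_eq_smul_one]
  module

theorem antipode_y : antipode hqp (y q p) = algebraMap k (A q p) p
    - (y q p - algebraMap k (A q p) p) * ((b q p)⁻¹ : (A q p)ˣ) := by
  rw [y_eq]
  simp only [map_add, map_smul, antipode_z, antipode_b, add_mul, sub_mul,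
    smul_mul_assoc, Units.mul_inv, one_mul, Algebra.algebraMap_eq_smul_one]
  module

theorem isRightCoideal : (hopfStructure hqp).IsRightCoideal (B q p) := by
  have key : B q p ≤
      ((Algebra.TensorProduct.map (B q p).val (AlgHom.id k (A q p))).range).comap (comul hqp) := by
    refine Algebra.adjoin_le ?_
    rintro u (rfl | rfl)
    · refine ⟨1 ⊗ₜ (x q p - q • (a q p : A q p)) + ⟨x q p, x_mem q p⟩ ⊗ₜ (a q p : A q p), ?_⟩
      exact (by simp : _ = _).trans (comul_x hqp).symm
    · refine ⟨1 ⊗ₜ (y q p - p • (b q p : A q p)) + ⟨y q p, y_mem q p⟩ ⊗ₜ (b q p : A q p), ?_⟩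
      exact (by simp : _ = _).trans (comul_y hqp).symm
  intro f hf
  obtain ⟨w, hw⟩ := key hf
  exact ⟨w, hw⟩

end

/-! ### Eigenvectors of conjugation, and the doubled representation -/

/-- Relations expressing the subalgebra generated by `a`, `b` and `t = e + f` through a square
root `β` of `a`, with `b = β ^ 3`, and the eigenvectors `e`, `f` of the conjugation by `β`. -/
structure EigenRel {k : Type*} (ω c : k) {S : Type*} [Field k] [Ring S] [Algebra k S]
    (β β' e f : S) : Prop where
  mul_inv : β * β' = 1
  inv_mul : β' * β = 1
  βe : β * e = ω ^ 2 • (e * β)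
  βf : β * f = ω • (f * β)
  ef : e * f = ω ^ 2 • (f * e) + c • (1 - β * β * β * β)

section

variable {k : Type*} [Field k] {ω c : k}

section

variable {S : Type*} [Ring S] [Algebra k S] {β β' e f : S}

namespace EigenRel

variable (h : EigenRel ω c β β' e f)
include h

theorem bt (hω : ω ^ 2 + ω + 1 = 0) : Commute (β * β * β) (e + f) := by
  have h1 := h.βe
  have h2 := h.βf
  have h1' (w : S) : β * (e * w) = ω ^ 2 • (e * (β * w)) := by
    rw [← mul_assoc, h1, smul_mul_assoc, mul_assoc]
  have h2' (w : S) : β * (f * w) = ω • (f * (β * w)) := by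
    rw [← mul_assoc, h2, smul_mul_assoc, mul_assoc]
  change _ * _ = _ * _
  simp only [mul_add, add_mul, mul_assoc, h1, h2, h1', h2', mul_smul_comm, smul_smul]
  match_scalars <;> grind

theorem aat (hω : ω ^ 2 + ω + 1 = 0) :
    β * β * (β * β) * (e + f) + β * β * (e + f) * (β * β) + (e + f) * (β * β) * (β * β) = 0 := by
  have h1 := h.βe
  have h2 := h.βf
  have h1' (w : S) : β * (e * w) = ω ^ 2 • (e * (β * w)) := by
    rw [← mul_assoc, h1, smul_mul_assoc, mul_assoc]
  have h2' (w : S) : β * (f * w) = ω • (f * (β * w)) := by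
    rw [← mul_assoc, h2, smul_mul_assoc, mul_assoc]
  simp only [mul_add, add_mul, mul_assoc, h1, h2, h1', h2', mul_smul_comm, smul_smul,
    smul_mul_assoc]
  match_scalars <;> grind

/-- The `e e` and `f f` terms cancel by `1 + ω + ω² = 0`. The mixed terms add up to `(1 - ω) (e f -
ω² f e) β²`, which fixes the normalisation `3 c (1 - ω) = 1`. -/
theorem att (hω : ω ^ 2 + ω + 1 = 0) (hc : 3 * c * (1 - ω) = 1) (h3 : (3 : k) ≠ 0) :
    β * β * (e + f) * (e + f) + (e + f) * (β * β) * (e + f) + (e + f) * (e + f) * (β * β)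
      = (1 / 3 : k) • (β * β - β * β * (β * β) * (β * β)) := by
  have h1 := h.βe
  have h2 := h.βf
  have h1' (w : S) : β * (e * w) = ω ^ 2 • (e * (β * w)) := by
    rw [← mul_assoc, h1, smul_mul_assoc, mul_assoc]
  have h2' (w : S) : β * (f * w) = ω • (f * (β * w)) := by
    rw [← mul_assoc, h2, smul_mul_assoc, mul_assoc]
  have h4 : e * (f * (β * β)) = ω ^ 2 • (f * (e * (β * β)))
      + c • (β * β - β * (β * (β * (β * (β * β))))) := by
    rw [← mul_assoc, h.ef]
    simp only [add_mul, smul_mul_assoc, sub_mul, mul_assoc, one_mul]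
  simp only [mul_add, add_mul, mul_assoc, h1, h2, h1', h2', h4, mul_smul_comm, smul_smul,
    smul_mul_assoc]
  match_scalars <;> field_simp <;> grind

end EigenRel

end

section

variable {V : Type*} [AddCommGroup V] [Module k V]

/-- The operator `(v, w) ↦ (d w, v)` on `V × V`. -/
def crossOp (d : Module.End k V) : Module.End k (V × V) :=
  (d ∘ₗ LinearMap.snd k V V).prod (LinearMap.fst k V V)

-- An operator `z` with `z² = d` is adjoined by doubling the space. It commutes with the diagonal
-- operators `t` and `a` because `d` does, and it anticommutes with `b` because `b` acts with
-- opposite signs on the two copies.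
open LinearMap in
theorem EigenRel.skewRel {β β' e f : Module.End k V} (h : EigenRel ω c β β' e f)
    (hω : ω ^ 2 + ω + 1 = 0) (hc : 3 * c * (1 - ω) = 1) (h3 : (3 : k) ≠ 0) :
    SkewRel k (prodMap (β * β) (β * β)) (prodMap (β' * β') (β' * β'))
      (prodMap (β * β * β) (-(β * β * β))) (prodMap (e + f) (e + f))
      (crossOp ((e + f) * (e + f) * (e + f) - (1 / 3 : k) • (e + f)
        + (2 / 27 : k) • (1 - β * β * (β * β) * (β * β)))) := by
  have hbt := h.bt hω
  have haat := h.aat hω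
  have hatt := h.att hω hc h3
  have hbb : Commute (β * β * β) β := by
    change _ * _ = _ * _
    simp only [mul_assoc]
  have haat' : Commute (β * β * (β * β) * (β * β)) (e + f) := by
    have : β * β * (β * β) * (β * β) = β * β * β * (β * β * β) := by simp only [mul_assoc]
    rw [this]
    exact hbt.mul_left hbt
  have hda : Commute (β * β) ((e + f) * (e + f) * (e + f) - (1 / 3 : k) • (e + f)
        + (2 / 27 : k) • (1 - β * β * (β * β) * (β * β))) := by
    have := haat'.eq
    generalize e + f = t at *
    -- The difference `att * t - t * att` telescopes to the commutator of `a` with `t³`. As `a³`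
    -- commutes with `t`, this equals one third of the commutator of `a` with `t`.
    change _ * _ = _ * _
    linear_combination (norm := skip) hatt * t - t * hatt - (1 / 3 : k) • this
    simp only [mul_add, add_mul, mul_sub, sub_mul, smul_mul_assoc, mul_smul_comm, mul_assoc,
      mul_one, one_mul]
    module
  have hdt : Commute (e + f) ((e + f) * (e + f) * (e + f) - (1 / 3 : k) • (e + f)
        + (2 / 27 : k) • (1 - β * β * (β * β) * (β * β))) := by
    have hr := Commute.refl (e + f)
    exact (((hr.mul_right hr).mul_right hr).sub_right (hr.smul_right _)).add_right
      (((Commute.one_right _).sub_right haat'.symm).smul_right _)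
  have hdb : Commute (β * β * β) ((e + f) * (e + f) * (e + f) - (1 / 3 : k) • (e + f)
        + (2 / 27 : k) • (1 - β * β * (β * β) * (β * β))) := by
    have hq := hbb.mul_right hbb
    exact (((hbt.mul_right hbt).mul_right hbt).sub_right (hbt.smul_right _)).add_right
      (((Commute.one_right _).sub_right ((hq.mul_right hq).mul_right hq)).smul_right _)
  have hinv : β * β * (β' * β') = 1 := by
    rw [mul_assoc, ← mul_assoc β β', h.mul_inv, one_mul, h.mul_inv]
  have hinv' : β' * β' * (β * β) = 1 := by
    rw [mul_assoc, ← mul_assoc β' β, h.inv_mul, one_mul, h.inv_mul]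
  generalize hd : (e + f) * (e + f) * (e + f) - (1 / 3 : k) • (e + f)
        + (2 / 27 : k) • (1 - β * β * (β * β) * (β * β)) = d at *
  generalize e + f = t at *
  constructor
  · rw [prodMap_mul, hinv]; rfl
  · rw [prodMap_mul, hinv']; rfl
  · simp only [prodMap_mul, neg_mul_neg]
    simp only [mul_assoc]
  · simp only [prodMap_mul, neg_mul, mul_neg]
    simp only [mul_assoc]
  · ext1 <;> ext v <;> simp [crossOp]
    exact (congr($hda v)).symm
  · simp only [prodMap_mul, neg_mul, mul_neg, hbt.eq]
  · ext1 <;> ext v <;> simp [crossOp]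
    exact (congr($hdt v)).symm
  · ext1 <;> ext v <;> simp [crossOp]
    exact congr($hdb v)
  · simp only [prodMap_mul, ← prodMap_add, haat]
    exact prodMap_zero
  · simp only [prodMap_mul, ← prodMap_add, hatt]
    rfl
  · simp only [prodMap_mul]
    ext1 <;> ext v <;> simp [crossOp, ← hd]

end

end

/-! ### The model space, graded by powers of `f` -/

section Model

variable {k : Type*} [Field k] {W : Type*} [AddCommGroup W] [Module k W]
  (ω c : k) (e₀ β₀ β₀i : Module.End k W)

/-- Multiplication by `f` on the model space. -/
noncomputable def modelF (k : Type*) [Field k] {W : Type*} [AddCommGroup W] [Module k W] : Module.End k (ℕ →₀ W) :=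
  Finsupp.lmapDomain (W) k fun i => i + 1

/-- Multiplication by `β` on the model space. -/
noncomputable def modelβ : Module.End k (ℕ →₀ W) :=
  Finsupp.lsum k fun i => (ω ^ i) • Finsupp.lsingle i ∘ₗ β₀

/-- Multiplication by the inverse of `β` on the model space. -/
noncomputable def modelβinv : Module.End k (ℕ →₀ W) :=
  -- For a primitive cube root of unity, `ω ^ (2 * i)` is the inverse of `ω ^ i`.
  Finsupp.lsum k fun i => (ω ^ (2 * i)) • Finsupp.lsingle i ∘ₗ β₀i

/-- Multiplication by `e` on the `i`-th component of the model space. -/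
noncomputable def modelEAux : ℕ → W →ₗ[k] (ℕ →₀ W)
  | 0 => Finsupp.lsingle 0 ∘ₗ e₀
  -- The recursion is forced by the relation for `e f`, applied to the component of degree `i`.
  | i + 1 => ω ^ 2 • (modelF k ∘ₗ modelEAux i)
      + c • ((1 - modelβ ω β₀ * modelβ ω β₀ * modelβ ω β₀ * modelβ ω β₀) ∘ₗ Finsupp.lsingle i)

/-- Multiplication by `e` on the model space. -/
noncomputable def modelE : Module.End k (ℕ →₀ W) :=
  Finsupp.lsum k (modelEAux ω c e₀ β₀)

theorem modelF_single (i : ℕ) (w : W) :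
    modelF k (Finsupp.single i w) = Finsupp.single (i + 1) w := by
  simp [modelF]

theorem modelβ_single (i : ℕ) (w : W) :
    modelβ ω β₀ (Finsupp.single i w) = ω ^ i • Finsupp.single i (β₀ w) := by
  simp [modelβ]

theorem modelβinv_single (i : ℕ) (w : W) :
    modelβinv ω β₀i (Finsupp.single i w) = ω ^ (2 * i) • Finsupp.single i (β₀i w) := by
  simp [modelβinv]

theorem modelE_single_zero (w : W) :
    modelE ω c e₀ β₀ (Finsupp.single 0 w) = Finsupp.single 0 (e₀ w) := by
  simp [modelE, modelEAux]

theorem modelE_single_succ (i : ℕ) (w : W) :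
    modelE ω c e₀ β₀ (Finsupp.single (i + 1) w) = ω ^ 2 • modelF k (modelE ω c e₀ β₀ (Finsupp.single i w))
      + c • (1 - modelβ ω β₀ * modelβ ω β₀ * modelβ ω β₀ * modelβ ω β₀) (Finsupp.single i w) := by
  simp [modelE, modelEAux]

/-- Two operators on the model space agree if they agree on the base and the agreement propagates
along `f`. -/
theorem model_ext {P Q : Module.End k (ℕ →₀ W)}
    (h0 : ∀ w, P (Finsupp.single 0 w) = Q (Finsupp.single 0 w))
    (hs : ∀ v, P v = Q v → P (modelF k v) = Q (modelF k v)) : P = Q := by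
  refine Finsupp.lhom_ext fun i w => ?_
  induction i with
  | zero => exact h0 w
  | succ i ih => rw [← modelF_single (k := k)]; exact hs _ ih

variable {ω c} in
theorem modelEF : modelE ω c e₀ β₀ * modelF k = ω ^ 2 • (modelF k * modelE ω c e₀ β₀)
    + c • (1 - modelβ ω β₀ * modelβ ω β₀ * modelβ ω β₀ * modelβ ω β₀) := by
  refine Finsupp.lhom_ext fun i w => ?_
  simp only [Module.End.mul_apply, modelF_single, modelE_single_succ, LinearMap.add_apply,
    LinearMap.smul_apply]

variable {ω c} in
theorem modelβF : modelβ ω β₀ * modelF k = ω • (modelF k * modelβ ω β₀) := by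
  refine Finsupp.lhom_ext fun i w => ?_
  simp only [Module.End.mul_apply, modelF_single, modelβ_single,
    LinearMap.smul_apply, map_smul, smul_smul]
  rw [pow_succ']

variable {ω c} in
theorem modelEigenRel (hω : ω ^ 2 + ω + 1 = 0) (hβ : β₀ * β₀i = 1)
    (hβ' : β₀i * β₀ = 1) (hβe : β₀ * e₀ = ω ^ 2 • (e₀ * β₀)) :
    EigenRel ω c (modelβ ω β₀) (modelβinv ω β₀i) (modelE ω c e₀ β₀) (modelF k) where
  ef := modelEF e₀ β₀
  βf := modelβF β₀
  mul_inv := by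
    have h3 : ω ^ 3 = 1 := by linear_combination (ω - 1) * hω
    refine Finsupp.lhom_ext fun i w => ?_
    have hw : β₀ (β₀i w) = w := congr($hβ w)
    simp only [Module.End.mul_apply, modelβinv_single, map_smul, modelβ_single, smul_smul, hw]
    rw [← pow_add, show 2 * i + i = 3 * i by ring, pow_mul, h3]
    simp
  inv_mul := by
    have h3 : ω ^ 3 = 1 := by linear_combination (ω - 1) * hω
    refine Finsupp.lhom_ext fun i w => ?_
    have hw : β₀i (β₀ w) = w := congr($hβ' w)
    simp only [Module.End.mul_apply, modelβinv_single, map_smul, modelβ_single, smul_smul, hw]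
    rw [← pow_add, show i + 2 * i = 3 * i by ring, pow_mul, h3]
    simp
  βe := by
    apply model_ext
    · intro w
      have : β₀ (e₀ w) = ω ^ 2 • e₀ (β₀ w) := congr($hβe w)
      simp [modelE_single_zero, modelβ_single, this]
    -- Both sides at `f v` reduce to `ω² f e β v + c (1 - β⁴) β v`, using `ω³ = 1`.
    · intro v hv
      have hEF (v) : modelE ω c e₀ β₀ (modelF k v) = ω ^ 2 • modelF k (modelE ω c e₀ β₀ v)
          + c • (v - modelβ ω β₀ (modelβ ω β₀ (modelβ ω β₀ (modelβ ω β₀ v)))) := congr($(modelEF e₀ β₀) v)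
      have hβF (v) : modelβ ω β₀ (modelF k v) = ω • modelF k (modelβ ω β₀ v) := congr($(modelβF β₀) v)
      simp only [Module.End.mul_apply, LinearMap.smul_apply] at hv ⊢
      simp only [hEF, hβF, map_add, map_sub, map_smul, hv]
      match_scalars <;> grind

/-- `v` vanishes above degree `m`. -/
def DegLE (m : ℕ) (v : ℕ →₀ W) : Prop := ∀ n, m < n → v n = 0

theorem modelF_apply_succ (v : ℕ →₀ W) (n : ℕ) : modelF k v (n + 1) = v n :=
  Finsupp.mapDomain_apply (add_left_injective 1) v n

theorem modelβ_apply (v : ℕ →₀ W) (n : ℕ) : modelβ ω β₀ v n = ω ^ n • β₀ (v n) := by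
  induction v using Finsupp.induction_linear with
  | zero => simp
  | add v w hv hw => simp [hv, hw]
  | single i w =>
    rw [modelβ_single, Finsupp.smul_apply]
    by_cases h : i = n
    · subst h; simp
    · simp [Finsupp.single_eq_of_ne' h]

theorem DegLE.modelβ {m : ℕ} {v : ℕ →₀ W} (hv : DegLE m v) :
    DegLE m (modelβ ω β₀ v) := fun n hn => by
  rw [modelβ_apply, hv n hn, map_zero, smul_zero]

theorem DegLE.modelF {m : ℕ} {v : ℕ →₀ W} (hv : DegLE m v) :
    DegLE (m + 1) (modelF k v) := by
  rintro (_ | n) hn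
  · omega
  · rw [modelF_apply_succ]; exact hv n (by omega)

theorem DegLE.mono {m n : ℕ} {v : ℕ →₀ W} (hv : DegLE m v) (h : m ≤ n) :
    DegLE n v := fun i hi => hv i (by omega)

theorem DegLE.add {m : ℕ} {v w : ℕ →₀ W} (hv : DegLE m v) (hw : DegLE m w) :
    DegLE m (v + w) := fun n hn => by simp [hv n hn, hw n hn]

theorem DegLE.sub {m : ℕ} {v w : ℕ →₀ W} (hv : DegLE m v) (hw : DegLE m w) :
    DegLE m (v - w) := fun n hn => by simp [hv n hn, hw n hn]

theorem DegLE.smul {m : ℕ} {v : ℕ →₀ W} (hv : DegLE m v) (r : k) :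
    DegLE m (r • v) := fun n hn => by simp [hv n hn]

theorem degLE_single (m : ℕ) (w : W) :
    DegLE m (Finsupp.single m w : ℕ →₀ W) := fun n hn => by
  simp [Finsupp.single_eq_of_ne' hn.ne]

theorem degLE_modelE_single (m : ℕ) (w : W) :
    DegLE m (modelE ω c e₀ β₀ (Finsupp.single m w)) := by
  induction m with
  | zero => rw [modelE_single_zero]; exact degLE_single _ _
  | succ m ih =>
    rw [modelE_single_succ]
    have h1 := degLE_single m w
    exact ((ih.modelF (k := k)).smul _).add
      (((h1.sub (h1.modelβ ω β₀ |>.modelβ ω β₀ |>.modelβ ω β₀ |>.modelβ ω β₀)).smul _).mono (by omega))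

theorem DegLE.modelE {m : ℕ} {v : ℕ →₀ W} (hv : DegLE m v) :
    DegLE m (modelE ω c e₀ β₀ v) := by
  intro n hn
  rw [← v.sum_single, Finsupp.sum, map_sum, Finsupp.finsetSum_apply]
  refine Finset.sum_eq_zero fun i hi => degLE_modelE_single ω c e₀ β₀ i (v i) n ?_
  by_contra h
  exact Finsupp.mem_support_iff.mp hi (hv i (by omega))

/-- The action of `x` on the diagonal copies of the model space. -/
noncomputable def modelX (r : k) : Module.End k (ℕ →₀ W) :=
  modelE ω c e₀ β₀ + modelF k - (1 / 3 : k) • 1 + r • (modelβ ω β₀ * modelβ ω β₀)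

/-- Only the summand `f` of `x` raises the degree; `e`, `β` and scalars do not. So `x ^ m` has
leading term `f ^ m` on the base. -/
theorem modelX_pow_single (r : k) (m : ℕ) (w : W) :
    DegLE m ((modelX ω c e₀ β₀ r ^ m) (Finsupp.single 0 w)) ∧
      (modelX ω c e₀ β₀ r ^ m) (Finsupp.single 0 w) m = w := by
  induction m with
  | zero => exact ⟨degLE_single 0 w, by simp⟩
  | succ m ih =>
    rw [pow_succ']
    obtain ⟨h1, h2⟩ := ih
    rw [Module.End.mul_apply]
    generalize ((modelX ω c e₀ β₀ r ^ m) (Finsupp.single 0 w)) = v at *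
    have h3 := h1.modelE ω c e₀ β₀
    have h4 := (h1.modelβ ω β₀ |>.modelβ ω β₀).smul r
    have h5 := h1.smul (1 / 3 : k)
    have h6 : modelX ω c e₀ β₀ r v = modelE ω c e₀ β₀ v + modelF k v - (1 / 3 : k) • v
        + r • modelβ ω β₀ (modelβ ω β₀ v) := rfl
    rw [h6]
    have hm : m ≤ m + 1 := by omega
    refine ⟨(((h3.mono hm).add (h1.modelF (k := k))).sub (h5.mono hm)).add (h4.mono hm), ?_⟩
    rw [Finsupp.add_apply, Finsupp.sub_apply, Finsupp.add_apply, h3 _ (by omega),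
      h5 _ (by omega), h4 _ (by omega), modelF_apply_succ, h2]
    simp

/-- The base space generates a free `k[x]`-submodule of the model space. -/
theorem modelX_sum_injective (r : k) (P : ℕ →₀ W)
    (h : (P.sum fun m w => (modelX ω c e₀ β₀ r ^ m) (Finsupp.single 0 w)) = 0) : P = 0 := by
  by_contra hP
  have hne : P.support.Nonempty := Finsupp.support_nonempty_iff.mpr hP
  -- In the top degree `d` only the term `x ^ d` contributes, and it contributes `P d`.
  set d := P.support.max' hne with hd
  have hmem := P.support.max'_mem hne
  rw [← hd] at hmem
  have := congr($h d)
  rw [Finsupp.sum, Finsupp.finsetSum_apply, Finset.sum_eq_single d] at this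
  · rw [(modelX_pow_single ω c e₀ β₀ r d _).2] at this
    exact Finsupp.mem_support_iff.mp hmem (by simpa using this)
  · intro m hm hmd
    exact (modelX_pow_single ω c e₀ β₀ r m _).1 d (lt_of_le_of_ne (Finset.le_max' _ _ hm) hmd)
  · exact fun hx => absurd hmem hx

open Polynomial in
theorem modelX_aeval_independent (r : k) {ι : Type*} {w : ι → W} (hw : LinearIndependent k w)
    (I : Finset ι) (U : ι → k[X])
    (h : ∑ i ∈ I, aeval (modelX ω c e₀ β₀ r) (U i) (Finsupp.single 0 (w i)) = 0)
    {i : ι} (hi : i ∈ I) : U i = 0 := by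
  let P : ℕ →₀ W := ∑ i ∈ I, ∑ m ∈ (U i).support, Finsupp.single m ((U i).coeff m • w i)
  have hP : P = 0 := by
    apply modelX_sum_injective ω c e₀ β₀ r
    let Φ : (ℕ →₀ W) →ₗ[k] (ℕ →₀ W) :=
      Finsupp.lsum k fun m => (modelX ω c e₀ β₀ r ^ m) ∘ₗ Finsupp.lsingle 0
    have hΦ (m : ℕ) (w : W) :
        Φ (Finsupp.single m w) = (modelX ω c e₀ β₀ r ^ m) (Finsupp.single 0 w) := by simp [Φ]
    change Φ P = 0
    rw [← h, map_sum]
    refine Finset.sum_congr rfl fun i _ => ?_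
    rw [map_sum, aeval_def, eval₂_eq_sum, Polynomial.sum_def, LinearMap.sum_apply]
    refine Finset.sum_congr rfl fun m _ => ?_
    rw [hΦ, ← Algebra.smul_def, LinearMap.smul_apply, ← map_smul, Finsupp.smul_single]
  ext m
  have hm := congr($hP m)
  have hc (i : ι) : (∑ n ∈ (U i).support, Finsupp.single n ((U i).coeff n • w i)) m
      = (U i).coeff m • w i := by
    rw [Finsupp.finsetSum_apply, Finset.sum_eq_single m]
    · simp
    · intro n _ hn
      simp [Finsupp.single_eq_of_ne' hn]
    · intro hm
      simp [notMem_support_iff.mp hm]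
  simp only [P, Finsupp.finsetSum_apply] at hm
  simp only [← Finsupp.finsetSum_apply, hc] at hm
  exact linearIndependent_iff'.mp hw I (fun i => (U i).coeff m) hm i hi

end Model

/-! ### The base space, with basis `e ^ j β ^ n` -/

section Base

variable {k : Type*} [Field k] (ω : k)

/-- Multiplication by `e` on the base space. -/
noncomputable def baseE : Module.End k ((ℕ × ℤ) →₀ k) :=
  Finsupp.lmapDomain k k fun i => (i.1 + 1, i.2)

/-- Multiplication by `β` on the base space. -/
noncomputable def baseβ : Module.End k ((ℕ × ℤ) →₀ k) :=
  Finsupp.lsum k fun i => (ω ^ (2 * i.1)) • Finsupp.lsingle (i.1, i.2 + 1)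

/-- Multiplication by the inverse of `β` on the base space. -/
noncomputable def baseβinv : Module.End k ((ℕ × ℤ) →₀ k) :=
  Finsupp.lsum k fun i => (ω ^ i.1) • Finsupp.lsingle (i.1, i.2 - 1)

theorem baseE_single (i : ℕ × ℤ) (r : k) :
    baseE (Finsupp.single i r) = Finsupp.single (i.1 + 1, i.2) r := by
  simp [baseE]

theorem baseβ_single (i : ℕ × ℤ) (r : k) :
    baseβ ω (Finsupp.single i r) = ω ^ (2 * i.1) • Finsupp.single (i.1, i.2 + 1) r := by
  simp [baseβ]

theorem baseβinv_single (i : ℕ × ℤ) (r : k) :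
    baseβinv ω (Finsupp.single i r) = ω ^ i.1 • Finsupp.single (i.1, i.2 - 1) r := by
  simp [baseβinv]

variable {ω}

theorem baseβ_mul_inv (hω : ω ^ 2 + ω + 1 = 0) : baseβ ω * baseβinv ω = 1 := by
  have h3 : ω ^ 3 = 1 := by linear_combination (ω - 1) * hω
  refine Finsupp.lhom_ext fun i r => ?_
  simp only [Module.End.mul_apply, baseβinv_single, map_smul, baseβ_single, smul_smul]
  rw [← pow_add, show i.1 + 2 * i.1 = 3 * i.1 by ring, pow_mul, h3]
  simp

theorem baseβ_inv_mul (hω : ω ^ 2 + ω + 1 = 0) : baseβinv ω * baseβ ω = 1 := by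
  have h3 : ω ^ 3 = 1 := by linear_combination (ω - 1) * hω
  refine Finsupp.lhom_ext fun i r => ?_
  simp only [Module.End.mul_apply, baseβinv_single, map_smul, baseβ_single, smul_smul]
  rw [← pow_add, show 2 * i.1 + i.1 = 3 * i.1 by ring, pow_mul, h3]
  simp

theorem baseβ_mul_baseE : baseβ ω * baseE = ω ^ 2 • (baseE * baseβ ω) := by
  refine Finsupp.lhom_ext fun i r => ?_
  simp only [Module.End.mul_apply, baseE_single, map_smul, baseβ_single, LinearMap.smul_apply,
    smul_smul]
  rw [← pow_add, show 2 * (i.1 + 1) = 2 + 2 * i.1 by ring]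

end Base

/-! ### Commutation rules for `β` and the eigenvector, and spanning over `B` -/

section

variable {k : Type*} [Field k] {ω : k}

section Generic

variable {S : Type*} [Ring S] [Algebra k S] {a b : Sˣ} {t z : S}

/-- The eigenvector of conjugation by `a` in the span of the conjugates of `t`. -/
def eigenvec (ω : k) (a : Sˣ) (t : S) : S := a * t * (a⁻¹ : Sˣ) - ω ^ 2 • t

namespace SkewRel

variable (h : SkewRel k (a : S) (a⁻¹ : Sˣ) b t z)
include h

theorem units_commute : Commute b a := Units.ext h.ba

theorem root_sq : b * a⁻¹ * (b * a⁻¹) = a := by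
  have hbb : b * b = a * a * a := Units.ext h.bb
  rw [mul_assoc, ← mul_assoc a⁻¹, ← h.units_commute.inv_right.eq, mul_assoc, ← mul_assoc, hbb]
  group

theorem root_cube : b * a⁻¹ * (b * a⁻¹) * (b * a⁻¹) = b := by
  rw [h.root_sq, h.units_commute.inv_right.eq, mul_inv_cancel_left]

theorem conj_add (hω : ω ^ 2 + ω + 1 = 0) :
    ((a⁻¹ : Sˣ) * t * a : S) = ω • t - eigenvec ω a t := by
  have := congrArg (fun w => ((a⁻¹ : Sˣ) : S) * w * (a⁻¹ : Sˣ)) h.aat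
  simp only [mul_add, add_mul, mul_assoc, Units.inv_mul_cancel_left, Units.mul_inv, mul_one,
    mul_zero, zero_mul] at this
  rw [eigenvec]
  linear_combination (norm := skip) this
  simp only [mul_assoc]
  match_scalars <;> grind

/-- As `b` commutes with `t`, conjugation by `b a⁻¹` acts on `t` as conjugation by `a⁻¹`. -/
theorem root_mul_t (hω : ω ^ 2 + ω + 1 = 0) :
    ((b * a⁻¹ : Sˣ) : S) * t = (ω • t - eigenvec ω a t) * (b * a⁻¹ : Sˣ) := by
  rw [← h.conj_add hω, h.units_commute.inv_right.eq]
  simp only [Units.val_mul, mul_assoc, Units.mul_inv_cancel_left]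
  rw [h.bt]

theorem b_commute_eigenvec : Commute (b : S) (eigenvec ω a t) := by
  have hba : Commute (b : S) a := h.ba
  have hbt : Commute (b : S) t := h.bt
  exact ((hba.mul_right hbt).mul_right hba.units_inv_right).sub_right (hbt.smul_right _)

theorem z_commute_eigenvec : Commute z (eigenvec ω a t) := by
  have hza : Commute z a := h.za
  have hzt : Commute z t := h.zt
  exact ((hza.mul_right hzt).mul_right hza.units_inv_right).sub_right (hzt.smul_right _)

theorem root_mul_eigenvec (hω : ω ^ 2 + ω + 1 = 0) :
    ((b * a⁻¹ : Sˣ) : S) * eigenvec ω a t = ω ^ 2 • (eigenvec ω a t * (b * a⁻¹ : Sˣ)) := by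
  have key : ((a⁻¹ : Sˣ) * eigenvec ω a t * a : S) = ω ^ 2 • eigenvec ω a t := by
    have h1 : ((a⁻¹ : Sˣ) * eigenvec ω a t * a : S) = t - ω ^ 2 • ((a⁻¹ : Sˣ) * t * a : S) := by
      simp [eigenvec, mul_sub, sub_mul, mul_assoc]
    rw [h1, h.conj_add hω]
    match_scalars <;> grind
  rw [h.units_commute.inv_right.eq, ← smul_mul_assoc, ← key]
  simp only [Units.val_mul, mul_assoc, Units.mul_inv_cancel_left]
  rw [h.b_commute_eigenvec.eq]

theorem root_mul_z : ((b * a⁻¹ : Sˣ) : S) * z = -(z * (b * a⁻¹ : Sˣ)) := by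
  have hza : Commute z a := h.za
  rw [Units.val_mul, mul_assoc, ← hza.units_inv_right.eq, ← mul_assoc, h.bz, neg_mul, mul_assoc]

theorem root_inv_mul_t (hω : ω ^ 2 + ω + 1 = 0) :
    (((b * a⁻¹)⁻¹ : Sˣ) : S) * t
      = (ω ^ 2 • t + eigenvec ω a t) * ((b * a⁻¹)⁻¹ : Sˣ) := by
  rw [Units.inv_mul_eq_iff_eq_mul, ← mul_assoc, mul_add, mul_smul_comm, h.root_mul_t hω,
    h.root_mul_eigenvec hω, ← smul_mul_assoc, ← smul_mul_assoc, ← add_mul,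
    Units.mul_inv_cancel_right]
  match_scalars <;> grind

theorem root_inv_mul_eigenvec (hω : ω ^ 2 + ω + 1 = 0) :
    (((b * a⁻¹)⁻¹ : Sˣ) : S) * eigenvec ω a t
      = ω • (eigenvec ω a t * ((b * a⁻¹)⁻¹ : Sˣ)) := by
  rw [Units.inv_mul_eq_iff_eq_mul, mul_smul_comm, ← mul_assoc,
    h.root_mul_eigenvec hω, smul_mul_assoc, Units.mul_inv_cancel_right]
  match_scalars <;> grind

theorem root_inv_mul_z :
    (((b * a⁻¹)⁻¹ : Sˣ) : S) * z = -(z * ((b * a⁻¹)⁻¹ : Sˣ)) := by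
  rw [Units.inv_mul_eq_iff_eq_mul, mul_neg, ← mul_assoc, h.root_mul_z, neg_mul, neg_neg,
    Units.mul_inv_cancel_right]

/-- This is `att` multiplied by `a⁻¹` on the right, with the conjugates of `t` expressed through `t`
and the eigenvector. -/
theorem eigenvec_mul_t [CharZero k] (hω : ω ^ 2 + ω + 1 = 0) :
    eigenvec ω a t * t = ω ^ 2 • (t * eigenvec ω a t)
      - ω • (eigenvec ω a t * eigenvec ω a t) + (ω / 3) • (1 - a * a : S) := by
  have := congrArg (fun w => w * ((a⁻¹ : Sˣ) : S)) h.att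
  simp only [add_mul, sub_mul, smul_mul_assoc, mul_assoc, Units.mul_inv, mul_one] at this
  have hc : (a : S) * (t * (t * (a⁻¹ : Sˣ)))
      = a * (t * ((a⁻¹ : Sˣ) * (a * (t * (a⁻¹ : Sˣ))))) := by simp
  rw [hc] at this
  rw [eigenvec]
  linear_combination (norm := skip) ω • this
  simp only [mul_sub, sub_mul, mul_assoc, smul_mul_assoc, mul_smul_comm,
    Units.inv_mul_cancel_left]
  match_scalars <;> grind

end SkewRel

end Generic

section Spanning

variable [CharZero k] {q p : k}

/-- The unit `b a⁻¹`, a square root of `a`. -/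
noncomputable def root (q p : k) : (A q p)ˣ := b q p * (a q p)⁻¹

/-- The monomials forming a basis of `A` over `B`. -/
noncomputable def monom (ω q p : k) (i : ℕ × ℤ) : A q p :=
  eigenvec ω (a q p) (t q p) ^ i.1 * (root q p ^ i.2 : (A q p)ˣ)

/-- The `B`-submodule of `A` spanned by the monomials. -/
noncomputable def monomSpan (ω q p : k) : Submodule (B q p) (A q p) :=
  Submodule.span (B q p) (Set.range (monom ω q p))

theorem smul_mem_monomSpan (r : k) {v : A q p} (hv : v ∈ monomSpan ω q p) :
    r • v ∈ monomSpan ω q p := by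
  rw [Algebra.smul_def]
  exact (monomSpan ω q p).smul_mem (algebraMap k (B q p) r) hv

theorem mul_mem_monomSpan {g : A q p}
    (hg : ∀ i, monom ω q p i * g ∈ monomSpan ω q p) {v : A q p}
    (hv : v ∈ monomSpan ω q p) : v * g ∈ monomSpan ω q p := by
  induction hv using Submodule.span_induction with
  | mem v hv => obtain ⟨i, rfl⟩ := hv; exact hg i
  | zero => rw [zero_mul]; exact zero_mem _
  | add v w _ _ hv hw => rw [add_mul]; exact add_mem hv hw
  | smul r v _ hv =>
    have : r • v * g = r • (v * g) := mul_assoc _ _ _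
    rw [this]
    exact Submodule.smul_mem _ _ hv

theorem monom_mem (i : ℕ × ℤ) : monom ω q p i ∈ monomSpan ω q p :=
  Submodule.subset_span ⟨i, rfl⟩

theorem mul_root_mem {v : A q p} (hv : v ∈ monomSpan ω q p) :
    v * (root q p : A q p) ∈ monomSpan ω q p := by
  refine mul_mem_monomSpan (fun i => ?_) hv
  have : monom ω q p i * root q p = monom ω q p (i.1, i.2 + 1) := by
    rw [monom, monom, mul_assoc, ← Units.val_mul, ← zpow_add_one]
  rw [this]
  exact monom_mem _

theorem mul_root_inv_mem {v : A q p} (hv : v ∈ monomSpan ω q p) :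
    v * ((root q p)⁻¹ : (A q p)ˣ) ∈ monomSpan ω q p := by
  refine mul_mem_monomSpan (fun i => ?_) hv
  have : monom ω q p i * ((root q p)⁻¹ : (A q p)ˣ) = monom ω q p (i.1, i.2 - 1) := by
    rw [monom, monom, mul_assoc, ← Units.val_mul, ← zpow_sub_one]
  rw [this]
  exact monom_mem _

/-- Integer induction on the exponent of `β`: once `g` can be moved past `β` and `β⁻¹`, only the
monomials with exponent `0` remain to be checked. -/
theorem mul_mem_of_pow {g : A q p}
    (h0 : ∀ j, eigenvec ω (a q p) (t q p) ^ j * g ∈ monomSpan ω q p)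
    (hs : ∀ v ∈ monomSpan ω q p, v * g ∈ monomSpan ω q p →
      v * (root q p : A q p) * g ∈ monomSpan ω q p)
    (hp : ∀ v ∈ monomSpan ω q p, v * g ∈ monomSpan ω q p →
      v * ((root q p)⁻¹ : (A q p)ˣ) * g ∈ monomSpan ω q p) {v : A q p}
    (hv : v ∈ monomSpan ω q p) : v * g ∈ monomSpan ω q p := by
  refine mul_mem_monomSpan ?_ hv
  rintro ⟨j, n⟩
  induction n using Int.induction_on with
  | zero => simpa [monom] using h0 j
  | succ n ih =>
    have := hs _ (monom_mem _) ih
    rwa [monom, mul_assoc (_ ^ _), ← Units.val_mul, ← zpow_add_one] at this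
  | pred n ih =>
    have := hp _ (monom_mem _) ih
    rwa [monom, mul_assoc (_ ^ _), ← Units.val_mul, ← zpow_sub_one] at this

variable (hqp : p ^ 2 = q ^ 2 + q ^ 3) (hω : ω ^ 2 + ω + 1 = 0)
include hqp

theorem root_sq : root q p * root q p = a q p := (skewRel hqp).root_sq

theorem root_cube : root q p * root q p * root q p = b q p := (skewRel hqp).root_cube

include hω

theorem mul_eigenvec_mem {v : A q p} (hv : v ∈ monomSpan ω q p) :
    v * eigenvec ω (a q p) (t q p) ∈ monomSpan ω q p := by
  refine mul_mem_of_pow (fun j => ?_) (fun v _ h => ?_) (fun v _ h => ?_) hv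
  · rw [← pow_succ]
    simpa [monom] using monom_mem (ω := ω) (q := q) (p := p) (j + 1, 0)
  · rw [mul_assoc, root, (skewRel hqp).root_mul_eigenvec hω, mul_smul_comm, ← mul_assoc]
    exact smul_mem_monomSpan _ (mul_root_mem h)
  · rw [mul_assoc, root, (skewRel hqp).root_inv_mul_eigenvec hω, mul_smul_comm, ← mul_assoc]
    exact smul_mem_monomSpan _ (mul_root_inv_mem h)

theorem mul_t_mem {v : A q p} (hv : v ∈ monomSpan ω q p) :
    v * t q p ∈ monomSpan ω q p := by
  refine mul_mem_of_pow (fun j => ?_) (fun v hv h => ?_) (fun v hv h => ?_) hv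
  · have h0 (j : ℕ) : eigenvec ω (a q p) (t q p) ^ j ∈ monomSpan ω q p := by
      simpa [monom] using monom_mem (ω := ω) (q := q) (p := p) (j, 0)
    induction j with
    | zero =>
      have h1 : (1 : A q p) ∈ monomSpan ω q p := by simpa using h0 0
      have hx : x q p ∈ monomSpan ω q p := by
        have := (monomSpan ω q p).smul_mem ⟨x q p, x_mem q p⟩ h1
        rwa [Subalgebra.smul_def, smul_eq_mul, mul_one] at this
      have ha : (a q p : A q p) ∈ monomSpan ω q p := by
        have := mul_root_mem (mul_root_mem h1)
        rwa [one_mul, ← Units.val_mul, root_sq hqp] at this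
      -- Here `x` lies in `B · 1` and `a` is the monomial `β²`.
      rw [pow_zero, one_mul, t]
      exact sub_mem (add_mem hx (smul_mem_monomSpan _ h1)) (smul_mem_monomSpan _ ha)
    | succ j ih =>
      have ha := mul_root_mem (mul_root_mem (mul_root_mem (mul_root_mem (h0 j))))
      simp only [mul_assoc, ← Units.val_mul] at ha
      rw [← mul_assoc (root q p), root_sq hqp] at ha
      -- Moving `t` left past one eigenvector leaves a term covered by `ih` and corrections without
      -- `t`.
      rw [pow_succ, mul_assoc, (skewRel hqp).eigenvec_mul_t hω]
      simp only [mul_add, mul_sub, mul_smul_comm, ← mul_assoc, mul_one]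
      refine add_mem (sub_mem (smul_mem_monomSpan _ (mul_eigenvec_mem hqp hω ih))
        (smul_mem_monomSpan _ (mul_eigenvec_mem hqp hω (mul_eigenvec_mem hqp hω (h0 j)))))
        (smul_mem_monomSpan _ (sub_mem (h0 j) ?_))
      simpa only [Units.val_mul, ← mul_assoc] using ha
  · rw [mul_assoc, root, (skewRel hqp).root_mul_t hω, ← mul_assoc, mul_sub, mul_smul_comm]
    exact mul_root_mem (sub_mem (smul_mem_monomSpan _ h) (mul_eigenvec_mem hqp hω hv))
  · rw [mul_assoc, root, (skewRel hqp).root_inv_mul_t hω, ← mul_assoc, mul_add, mul_smul_comm]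
    exact mul_root_inv_mem (add_mem (smul_mem_monomSpan _ h) (mul_eigenvec_mem hqp hω hv))

omit hω in
theorem mul_z_mem {v : A q p} (hv : v ∈ monomSpan ω q p) :
    v * z q p ∈ monomSpan ω q p := by
  refine mul_mem_of_pow (fun j => ?_) (fun v hv h => ?_) (fun v hv h => ?_) hv
  · have h0 : eigenvec ω (a q p) (t q p) ^ j ∈ monomSpan ω q p := by
      simpa [monom] using monom_mem (ω := ω) (q := q) (p := p) (j, 0)
    have hy : y q p * eigenvec ω (a q p) (t q p) ^ j ∈ monomSpan ω q p :=
      (monomSpan ω q p).smul_mem ⟨y q p, y_mem q p⟩ h0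
    have hb := mul_root_mem (mul_root_mem (mul_root_mem h0))
    rw [mul_assoc, mul_assoc, ← Units.val_mul, ← Units.val_mul, ← mul_assoc, root_cube hqp,
      ← ((skewRel hqp).b_commute_eigenvec.pow_right j).eq] at hb
    -- Since `z` commutes with the eigenvector, it can be moved to the left, where `z = y - p b`
    -- with `y` in `B` and `b = β³`.
    rw [← ((skewRel hqp).z_commute_eigenvec.pow_right j).eq, z, sub_mul, smul_mul_assoc]
    exact sub_mem hy (smul_mem_monomSpan _ hb)
  · rw [mul_assoc, root, (skewRel hqp).root_mul_z, mul_neg, ← mul_assoc]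
    exact neg_mem (mul_root_mem h)
  · rw [mul_assoc, root, (skewRel hqp).root_inv_mul_z, mul_neg, ← mul_assoc]
    exact neg_mem (mul_root_inv_mem h)

theorem monomSpan_eq_top : monomSpan ω q p = ⊤ := by
  let T : Subalgebra k (A q p) :=
    { carrier := {g | ∀ v ∈ monomSpan ω q p, v * g ∈ monomSpan ω q p}
      mul_mem' := fun {g g'} hg hg' v hv => by
        rw [← mul_assoc]; exact hg' _ (hg v hv)
      add_mem' := fun {g g'} hg hg' v hv => by
        rw [mul_add]; exact add_mem (hg v hv) (hg' v hv)
      algebraMap_mem' := fun r v hv => by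
        rw [← Algebra.commutes, ← Algebra.smul_def]; exact smul_mem_monomSpan r hv }
  have hT : T = ⊤ := by
    refine subalgebra_eq_top (fun v hv => mul_t_mem hqp hω hv) (fun v hv => mul_z_mem hqp hv)
      (fun v hv => ?_) (fun v hv => ?_) (fun v hv => ?_)
    · have := mul_root_mem (mul_root_mem hv)
      rwa [mul_assoc, ← Units.val_mul, root_sq hqp] at this
    · have := mul_root_inv_mem (mul_root_inv_mem hv)
      rwa [mul_assoc, ← Units.val_mul, ← mul_inv_rev, root_sq hqp] at this
    · have := mul_root_mem (mul_root_mem (mul_root_mem hv))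
      rwa [mul_assoc, mul_assoc, ← Units.val_mul, ← Units.val_mul, ← mul_assoc, root_cube hqp]
        at this
  rw [eq_top_iff]
  rintro g -
  have hg : g ∈ T := hT ▸ Algebra.mem_top
  have h1 : (1 : A q p) ∈ monomSpan ω q p := by
    simpa [monom] using monom_mem (ω := ω) (q := q) (p := p) (0, 0)
  simpa using hg 1 h1

end Spanning

end

/-! ### Linear independence through the representation -/

section Independence

variable {k : Type*} [Field k] [CharZero k] {ω q p : k}

theorem one_sub_ne_zero (hω : ω ^ 2 + ω + 1 = 0) : 1 - ω ≠ 0 := by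
  intro h
  have h1 : ω = 1 := by linear_combination -h
  rw [h1] at hω
  norm_num at hω

theorem ne_zero_of_root (hω : ω ^ 2 + ω + 1 = 0) : ω ≠ 0 := by
  rintro rfl
  norm_num at hω

/-- The coefficient in the commutation relation of `e` and `f`. -/
noncomputable def coef (ω : k) : k := 1 / (3 * (1 - ω))

theorem coef_spec (hω : ω ^ 2 + ω + 1 = 0) : 3 * coef ω * (1 - ω) = 1 := by
  have := one_sub_ne_zero hω
  rw [coef]
  field_simp

/-- A space with independent vectors `e ^ j β ^ n`, on which `e` and `β` act. -/
structure BaseModel (ω : k) {W : Type*} [AddCommGroup W] [Module k W]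
    (e₀ β₀ β₀i : Module.End k W) (w : ℕ × ℤ → W) : Prop where
  mul_inv : β₀ * β₀i = 1
  inv_mul : β₀i * β₀ = 1
  βe : β₀ * e₀ = ω ^ 2 • (e₀ * β₀)
  e_apply (j : ℕ) (n : ℤ) : e₀ (w (j, n)) = w (j + 1, n)
  β_apply (n : ℤ) : β₀ (w (0, n)) = w (0, n + 1)
  independent : LinearIndependent k w

theorem baseModel (hω : ω ^ 2 + ω + 1 = 0) :
    BaseModel ω baseE (baseβ ω) (baseβinv ω) fun i : ℕ × ℤ => Finsupp.single i (1 : k) where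
  mul_inv := baseβ_mul_inv hω
  inv_mul := baseβ_inv_mul hω
  βe := baseβ_mul_baseE
  e_apply j n := baseE_single _ _
  β_apply n := by simp [baseβ_single]
  independent := Finsupp.linearIndependent_single_one k (ℕ × ℤ)

variable {W : Type*} [AddCommGroup W] [Module k W] {e₀ β₀ β₀i : Module.End k W} {w : ℕ × ℤ → W}
  (hqp : p ^ 2 = q ^ 2 + q ^ 3) (hω : ω ^ 2 + ω + 1 = 0) (hW : BaseModel ω e₀ β₀ β₀i w)

include hω hW in
theorem op_eigenRel : EigenRel ω (coef ω) (modelβ ω β₀) (modelβinv ω β₀i)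
    (modelE ω (coef ω) e₀ β₀) (modelF k) :=
  modelEigenRel e₀ β₀ β₀i hω hW.mul_inv hW.inv_mul hW.βe

/-- The representation of `A` on two copies of the model space. -/
noncomputable def rep : A q p →ₐ[k] Module.End k ((ℕ →₀ W) × (ℕ →₀ W)) :=
  ((op_eigenRel hω hW).skewRel hω (coef_spec hω) three_ne_zero).lift hqp

theorem rep_x : rep hqp hω hW (x q p) = LinearMap.prodMapAlgHom k _ _ (modelX ω (coef ω) e₀ β₀ (q + 1 / 3), modelX ω (coef ω) e₀ β₀ (q + 1 / 3)) := by
  exact ((op_eigenRel hω hW).skewRel hω (coef_spec hω) three_ne_zero).lift_x hqp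

open Polynomial in
theorem rep_aeval_x (U : k[X]) (v w : ℕ →₀ W) :
    rep hqp hω hW (aeval (x q p) U) (v, w) = (aeval (modelX ω (coef ω) e₀ β₀ (q + 1 / 3)) U v, aeval (modelX ω (coef ω) e₀ β₀ (q + 1 / 3)) U w) := by
  rw [← aeval_algHom_apply, rep_x, aeval_algHom_apply, aeval_prod_apply]
  rfl

theorem rep_y (v : ℕ →₀ W) : rep hqp hω hW (y q p) (v, 0)
    = (p • (modelβ ω β₀ * modelβ ω β₀ * modelβ ω β₀) v, v) := by
  rw [rep, SkewRel.lift_y]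
  simp [crossOp]

/-- Conjugation by `a = β²` multiplies `e` by `ω` and `f` by `ω²`, so subtracting `ω² t` kills `f`
and leaves `(ω - ω²) e`. -/
theorem rep_eigenvec (v : ℕ →₀ W) :
    rep hqp hω hW (eigenvec ω (a q p) (t q p)) (v, 0)
      = ((ω - ω ^ 2) • modelE ω (coef ω) e₀ β₀ v, 0) := by
  have hE := op_eigenRel hω hW
  rw [rep, eigenvec, map_sub, map_mul, map_mul, map_smul, SkewRel.lift_a, SkewRel.lift_t,
    SkewRel.lift_a_inv]
  have key : ∀ {S : Type _} [Ring S] [Algebra k S] {β β' e f : S},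
      EigenRel ω (coef ω) β β' e f → β * β * (e + f) * (β' * β') - ω ^ 2 • (e + f)
        = (ω - ω ^ 2) • e := by
    intro S _ _ β β' e f h
    have h1 : β * β * (e + f) = (ω ^ 4 • e + ω ^ 2 • f) * (β * β) := by
      have h1 := h.βe
      have h2 := h.βf
      have h1' (w : S) : β * (e * w) = ω ^ 2 • (e * (β * w)) := by
        rw [← mul_assoc, h1, smul_mul_assoc, mul_assoc]
      have h2' (w : S) : β * (f * w) = ω • (f * (β * w)) := by
        rw [← mul_assoc, h2, smul_mul_assoc, mul_assoc]
      simp only [mul_add, add_mul, mul_assoc, h1, h2, h1', h2', mul_smul_comm, smul_smul,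
        smul_mul_assoc]
      match_scalars <;> ring
    have hinv : β * β * (β' * β') = 1 := by
      rw [mul_assoc, ← mul_assoc β β', h.mul_inv, one_mul, h.mul_inv]
    rw [h1, mul_assoc, hinv, mul_one]
    match_scalars <;> grind
  have := congr($(key hE) v)
  exact Prod.ext this (by simp)

theorem rep_root (v : ℕ →₀ W) :
    rep hqp hω hW (root q p) (v, 0) = (modelβ ω β₀ v, 0) := by
  have hE := op_eigenRel hω hW
  have h1 (v) : modelβ ω β₀ (modelβinv ω (β₀i) v) = v := congr($(hE.mul_inv) v)
  rw [rep, root, Units.val_mul, map_mul, SkewRel.lift_b, SkewRel.lift_a_inv]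
  simp [h1]

theorem rep_root_zpow (n : ℤ) :
    rep hqp hω hW (root q p ^ n : (A q p)ˣ) (Finsupp.single 0 (w (0, 0)), 0)
      = (Finsupp.single 0 (w (0, n)), 0) := by
  have hβ (n : ℤ) : rep hqp hω hW (root q p)
      (Finsupp.single 0 (w (0, n)), 0)
      = (Finsupp.single 0 (w (0, n + 1)), 0) := by
    rw [rep_root, modelβ_single, hW.β_apply]
    simp
  induction n using Int.induction_on with
  | zero => simp
  | succ n ih => rw [add_comm, zpow_one_add, Units.val_mul, map_mul, Module.End.mul_apply, ih, hβ,
      add_comm]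
  | pred n ih =>
    -- The step downwards follows by applying the inverse of `β` to the step upwards.
    have h := hβ (-n - 1)
    rw [sub_add_cancel] at h
    rw [sub_eq_neg_add, zpow_add, zpow_neg_one, Units.val_mul, map_mul, Module.End.mul_apply, ih,
      ← h, ← Module.End.mul_apply, ← map_mul, Units.inv_mul, map_one, Module.End.one_apply,
      sub_eq_neg_add]

theorem rep_monom (i : ℕ × ℤ) :
    rep hqp hω hW (monom ω q p i) (Finsupp.single 0 (w (0, 0)), 0)
      = (Finsupp.single 0 ((ω - ω ^ 2) ^ i.1 • w i), 0) := by
  obtain ⟨j, n⟩ := i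
  rw [monom, map_mul, Module.End.mul_apply, rep_root_zpow, map_pow]
  induction j with
  | zero => simp
  | succ j ih =>
    dsimp only at ih ⊢
    rw [pow_succ', Module.End.mul_apply, ih, rep_eigenvec, modelE_single_zero, map_smul,
      hW.e_apply, Finsupp.smul_single, smul_smul, ← pow_succ']

open Polynomial in
include hqp hω hW in
theorem monom_independent_of_baseModel (I : Finset (ℕ × ℤ)) (U V : ℕ × ℤ → k[X])
    (h : ∑ i ∈ I, (aeval (x q p) (U i) + y q p * aeval (x q p) (V i)) * monom ω q p i = 0)
    {i : ℕ × ℤ} (hi : i ∈ I) : U i = 0 ∧ V i = 0 := by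
  let w' (i : ℕ × ℤ) : W := (ω - ω ^ 2) ^ i.1 • w i
  have hw : LinearIndependent k w' := by
    have hne : ω - ω ^ 2 ≠ 0 := by
      rw [show ω - ω ^ 2 = ω * (1 - ω) by ring]
      exact mul_ne_zero (ne_zero_of_root hω) (one_sub_ne_zero hω)
    exact hW.independent.units_smul fun i => Units.mk0 _ (pow_ne_zero i.1 hne)
  have happ (i : ℕ × ℤ) :
      rep hqp hω hW ((aeval (x q p) (U i) + y q p * aeval (x q p) (V i)) * monom ω q p i)
        (Finsupp.single 0 (w (0, 0)), 0)
      = (aeval (modelX ω (coef ω) e₀ β₀ (q + 1 / 3)) (U i) (Finsupp.single 0 (w' i))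
        + p • (modelβ ω β₀ * modelβ ω β₀ * modelβ ω β₀)
          (aeval (modelX ω (coef ω) e₀ β₀ (q + 1 / 3)) (V i) (Finsupp.single 0 (w' i))),
        aeval (modelX ω (coef ω) e₀ β₀ (q + 1 / 3)) (V i) (Finsupp.single 0 (w' i))) := by
    rw [map_mul, Module.End.mul_apply, rep_monom, map_add, map_mul, LinearMap.add_apply,
      Module.End.mul_apply, rep_aeval_x, rep_aeval_x, map_zero, map_zero, rep_y]
    simp [w']
  have h1 := congr(rep hqp hω hW $h (Finsupp.single 0 (w (0, 0)), 0))
  rw [map_sum, LinearMap.sum_apply, map_zero, LinearMap.zero_apply] at h1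
  simp only [happ] at h1
  -- The relation is evaluated at the vector representing `1` in the first copy. The second
  -- component sees only `V`; once `V` vanishes, the first component sees only `U`.
  have hV (i) (hi : i ∈ I) : V i = 0 := by
    refine modelX_aeval_independent ω (coef ω) e₀ (β₀) (q + 1 / 3) hw I V ?_ hi
    have := congrArg Prod.snd h1
    rwa [Prod.snd_sum] at this
  refine ⟨?_, hV i hi⟩
  refine modelX_aeval_independent ω (coef ω) e₀ (β₀) (q + 1 / 3) hw I U ?_ hi
  have := congrArg Prod.fst h1
  rw [Prod.fst_sum] at this
  refine Eq.trans (Finset.sum_congr rfl fun i hi => ?_) this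
  simp [hV i hi]

open Polynomial in
include hqp hω in
/-- The monomials are linearly independent over `k[x] ⊕ y k[x]`. -/
theorem monom_independent (I : Finset (ℕ × ℤ)) (U V : ℕ × ℤ → k[X])
    (h : ∑ i ∈ I, (aeval (x q p) (U i) + y q p * aeval (x q p) (V i)) * monom ω q p i = 0)
    {i : ℕ × ℤ} (hi : i ∈ I) : U i = 0 ∧ V i = 0 :=
  monom_independent_of_baseModel hqp hω (baseModel hω) I U V h hi

end Independence

/-! ### The coordinate ring of the nodal cubic and `B` -/

section CoordinateRing

variable {k : Type*} [Field k]

open Polynomial in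
/-- Every element of the coordinate ring is of the form `u(X) + Y v(X)`. -/
theorem coordRing_exists_repr (r : CoordRing k) : ∃ U V : k[X],
    r = aeval (Ideal.Quotient.mk _ (MvPolynomial.X 0) : CoordRing k) U
      + (Ideal.Quotient.mk _ (MvPolynomial.X 1) : CoordRing k)
        * aeval (Ideal.Quotient.mk _ (MvPolynomial.X 0) : CoordRing k) V := by
  obtain ⟨P, rfl⟩ := Ideal.Quotient.mk_surjective r
  have hrel : (Ideal.Quotient.mk _ (MvPolynomial.X 1) : CoordRing k) ^ 2
      = (Ideal.Quotient.mk _ (MvPolynomial.X 0) : CoordRing k) ^ 2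
        + (Ideal.Quotient.mk _ (MvPolynomial.X 0) : CoordRing k) ^ 3 := by
    rw [← map_pow, ← map_pow, ← map_pow, ← map_add, Ideal.Quotient.eq]
    apply Ideal.subset_span
    rw [Set.mem_singleton_iff]
    ring
  induction P using MvPolynomial.induction_on with
  | C c => exact ⟨C c, 0, by simp; rfl⟩
  | add P Q hP hQ =>
    obtain ⟨U, V, h⟩ := hP
    obtain ⟨U', V', h'⟩ := hQ
    exact ⟨U + U', V + V', by rw [map_add, h, h', map_add, map_add]; ring⟩
  | mul_X P i hP =>
    obtain ⟨U, V, h⟩ := hP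
    fin_cases i
    · refine ⟨U * X, V * X, ?_⟩
      rw [map_mul, h, map_mul, map_mul, aeval_X]
      simp only [Fin.zero_eta]
      ring
    · refine ⟨V * (X ^ 2 + X ^ 3), U, ?_⟩
      rw [map_mul, h, map_mul, map_add, map_pow, map_pow, aeval_X, ← hrel]
      simp only [Fin.mk_one]
      ring

variable (q p : k)

/-- The parametrization of `B` by the coordinate ring of the nodal cubic. -/
noncomputable def coordHom : CoordRing k →ₐ[k] B q p :=
  Ideal.Quotient.liftₐ _ (MvPolynomial.aeval ![⟨x q p, x_mem q p⟩, ⟨y q p, y_mem q p⟩]) (by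
    have hle : Ideal.span {(MvPolynomial.X 1 ^ 2 - MvPolynomial.X 0 ^ 2 - MvPolynomial.X 0 ^ 3 :
        MvPolynomial (Fin 2) k)} ≤ RingHom.ker (MvPolynomial.aeval (R := k)
          ![(⟨x q p, x_mem q p⟩ : B q p), ⟨y q p, y_mem q p⟩]) := by
      rw [Ideal.span_singleton_le_iff_mem, RingHom.mem_ker]
      simp only [map_sub, map_pow, MvPolynomial.aeval_X, Matrix.cons_val_zero, Matrix.cons_val_one]
      apply Subtype.ext
      change y q p ^ 2 - x q p ^ 2 - x q p ^ 3 = 0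
      have h := proj_rel (Rel.cubic (q := q) (p := p))
      rw [map_add, map_pow, map_pow, map_pow] at h
      rw [sub_sub]
      exact sub_eq_zero_of_eq h
    exact fun r hr => RingHom.mem_ker.mp (hle hr))

theorem coordHom_X : coordHom q p (Ideal.Quotient.mk _ (MvPolynomial.X 0))
    = ⟨x q p, x_mem q p⟩ := by
  exact (Ideal.Quotient.lift_mk _ _ _).trans (MvPolynomial.aeval_X _ _)

theorem coordHom_Y : coordHom q p (Ideal.Quotient.mk _ (MvPolynomial.X 1))
    = ⟨y q p, y_mem q p⟩ := by
  exact (Ideal.Quotient.lift_mk _ _ _).trans (MvPolynomial.aeval_X _ _)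

open Polynomial in
theorem coordHom_repr (U V : k[X]) :
    (coordHom q p (aeval (Ideal.Quotient.mk _ (MvPolynomial.X 0) : CoordRing k) U
      + (Ideal.Quotient.mk _ (MvPolynomial.X 1) : CoordRing k)
        * aeval (Ideal.Quotient.mk _ (MvPolynomial.X 0) : CoordRing k) V) : A q p)
      = aeval (x q p) U + y q p * aeval (x q p) V := by
  rw [map_add, map_mul, ← aeval_algHom_apply, ← aeval_algHom_apply, coordHom_X, coordHom_Y]
  change (B q p).val _ + y q p * (B q p).val _ = _
  rw [← aeval_algHom_apply, ← aeval_algHom_apply]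
  rfl

theorem coordHom_surjective : Function.Surjective (coordHom q p) := by
  have hle : B q p ≤ ((B q p).val.comp (coordHom q p)).range := by
    refine Algebra.adjoin_le ?_
    rintro u (rfl | rfl)
    · exact ⟨Ideal.Quotient.mk _ (MvPolynomial.X 0), congrArg Subtype.val (coordHom_X q p)⟩
    · exact ⟨Ideal.Quotient.mk _ (MvPolynomial.X 1), congrArg Subtype.val (coordHom_Y q p)⟩
  intro v
  obtain ⟨r, hr⟩ := hle v.2
  exact ⟨r, Subtype.ext hr⟩

open Polynomial in
theorem B_exists_repr (v : B q p) :
    ∃ U V : k[X], (v : A q p) = aeval (x q p) U + y q p * aeval (x q p) V := by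
  obtain ⟨r, rfl⟩ := coordHom_surjective q p v
  obtain ⟨U, V, rfl⟩ := coordRing_exists_repr r
  exact ⟨U, V, coordHom_repr q p U V⟩

end CoordinateRing

/-! ### Injectivity of the parametrisation and the `B`-basis of `A` -/

section Main

variable {k : Type*} [Field k] [CharZero k] {ω q p : k}
  (hqp : p ^ 2 = q ^ 2 + q ^ 3) (hω : ω ^ 2 + ω + 1 = 0)
include hqp hω

/-- This is `monom_independent` for the single monomial `1`. -/
theorem coordHom_injective : Function.Injective (coordHom q p) := by
  rw [injective_iff_map_eq_zero]
  intro r hr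
  obtain ⟨U, V, rfl⟩ := coordRing_exists_repr r
  have h := coordHom_repr q p U V
  rw [hr, ZeroMemClass.coe_zero] at h
  obtain ⟨rfl, rfl⟩ := monom_independent hqp hω {(0, 0)} (fun _ => U) (fun _ => V)
    (by simp [← h]) (Finset.mem_singleton_self _)
  simp

theorem monom_linearIndependent : LinearIndependent (B q p) (monom ω q p) := by
  rw [linearIndependent_iff']
  intro I v hv i hi
  choose U V hUV using fun i => B_exists_repr q p (v i)
  obtain ⟨h1, h2⟩ := monom_independent hqp hω I U V
    (by rw [← hv]; exact Finset.sum_congr rfl fun i _ => by rw [← hUV]; rfl) hi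
  apply Subtype.ext
  rw [hUV, h1, h2]
  simp

/-- The basis of `A` as a left `B`-module. -/
noncomputable def monomBasis : Module.Basis (ℕ × ℤ) (B q p) (A q p) :=
  .mk (monom_linearIndependent hqp hω) (monomSpan_eq_top hqp hω).ge

end Main

end NodalCubic

open NodalCubic in
theorem theorem1 {k : Type*} [Field k] [IsAlgClosed k] [CharZero k] (q p : k)
    (hqp : p ^ 2 = q ^ 2 + q ^ 3) :
    -- a Hopf algebra structure on the algebra `A`, with the stated values on generators,
    -- for which `B` is a right coideal
    (∃ H : HopfStructure k (A q p),
      H.comul (x q p) =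
        1 ⊗ₜ[k] (x q p - q • (a q p : A q p)) + x q p ⊗ₜ[k] (a q p : A q p) ∧
      H.comul (y q p) =
        1 ⊗ₜ[k] (y q p - p • (b q p : A q p)) + y q p ⊗ₜ[k] (b q p : A q p) ∧
      H.comul (a q p) = (a q p : A q p) ⊗ₜ[k] (a q p : A q p) ∧
      H.comul (b q p) = (b q p : A q p) ⊗ₜ[k] (b q p : A q p) ∧
      H.counit (x q p) = q ∧ H.counit (y q p) = p ∧
      H.counit (a q p) = 1 ∧ H.counit (b q p) = 1 ∧
      H.antipode (x q p) = algebraMap k (A q p) q - (x q p - algebraMap k (A q p) q) * ((a q p)⁻¹ : (A q p)ˣ) ∧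
      H.antipode (y q p) = algebraMap k (A q p) p - (y q p - algebraMap k (A q p) p) * ((b q p)⁻¹ : (A q p)ˣ) ∧
      H.antipode (a q p) = ((a q p)⁻¹ : (A q p)ˣ) ∧
      H.antipode (b q p) = ((b q p)⁻¹ : (A q p)ˣ) ∧
      H.IsRightCoideal (B q p)) ∧
    -- `B` is the coordinate ring of the nodal cubic
    (∃ e : CoordRing k ≃ₐ[k] B q p,
      e (Ideal.Quotient.mk _ (MvPolynomial.X 0)) = ⟨x q p, x_mem q p⟩ ∧
      e (Ideal.Quotient.mk _ (MvPolynomial.X 1)) = ⟨y q p, y_mem q p⟩) ∧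
    -- `A` is free and faithfully flat as a left `B`-module
    Module.Free (B q p) (A q p) ∧ Module.FaithfullyFlat (B q p) (A q p) := by
  obtain ⟨ω, hω⟩ : ∃ ω : k, ω ^ 2 + ω + 1 = 0 := by
    obtain ⟨ω, hω⟩ := IsAlgClosed.exists_root
      (Polynomial.X ^ 2 + Polynomial.X + 1 : Polynomial k) (by
        rw [show (Polynomial.X ^ 2 + Polynomial.X + 1 : Polynomial k).degree = 2 by compute_degree!]
        norm_num)
    exact ⟨ω, by simpa using hω⟩
  refine ⟨⟨hopfStructure hqp, comul_x hqp, comul_y hqp, comul_a hqp, comul_b hqp, counit_x hqp,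
    counit_y hqp, counit_a hqp, counit_b hqp, antipode_x hqp, antipode_y hqp, antipode_a hqp,
    antipode_b hqp, isRightCoideal hqp⟩,
    ⟨AlgEquiv.ofBijective (coordHom q p) ⟨coordHom_injective hqp hω, coordHom_surjective q p⟩,
      coordHom_X q p, coordHom_Y q p⟩, ?_⟩
  have hfree : Module.Free (B q p) (A q p) := .of_basis (monomBasis hqp hω)
  -- A free module is faithfully flat once it is nonzero; the counit separates `1` from `0`.
  have hnt : Nontrivial (A q p) := by
    refine nontrivial_of_ne 1 0 fun h => ?_
    have := congrArg (counit hqp) h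
    rw [map_one, map_zero] at this
    exact one_ne_zero this
  exact ⟨hfree, inferInstance⟩
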